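/- For $z,q\in\mathbb C$ and $m\in\mathbb Z_{\ge0}$ let $$(z;q)_m=(1-z)(1-qz)\cdots(1-q^{m-1}z).$$ Let $n,K\ge 0$ be integers, let $q,t$ and $u_1,\dots,u_n,v_1,\dots,v_n$ be nonzero complex numbers, and assume that no denominator below vanishes, that is: $q^p\neq1$ for $1\le p\le K$; $u_i\ne q^pu_j$ and $v_i\neq q^pv_j$ for all $i\ne j$ and $0\le p<K$; and $v_a\ne q^pu_j$ for all $a,j$ and $0\le p<K$. Then, with both sums taken over all $n$-tuples $\mathbf k=(k_1,\dots,k_n)$ of non-negative integers such that $|\mathbf k|=k_1+\dots+k_n=K$, $$\sum_{|\mathbf k|=K}\prod_{i=1}^n\frac{(qt;q)_{k_i}}{(q;q)_{k_i}}\prod_{\substack{i,j=1\\ i\ne j}}^n\frac{(t^{-1}q^{-k_j}u_i/u_j;q)_{k_i}}{(q^{-k_j}u_i/u_j;q)_{k_i}}\prod_{a,j=1}^n\frac{(tu_j/v_a;q)_{k_j}}{(u_j/v_a;q)_{k_j}}$$ $$=\sum_{|\mathbf k|=K}\prod_{a=1}^n\frac{(qt;q)_{k_a}}{(q;q)_{k_a}}\prod_{\substack{a,b=1\\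 a\ne b}}^n\frac{(t^{-1}q^{-k_a}v_a/v_b;q)_{k_b}}{(q^{-k_a}v_a/v_b;q)_{k_b}}\prod_{a,j=1}^n\frac{(tu_j/v_a;q)_{k_a}}{(u_j/v_a;q)_{k_a}}.$$ Moreover, the same identity holds with every symbol $(z;q)_m$ replaced by the symmetric symbol $$[z;q]_m=\prod_{l=0}^{m-1}\left(q^{l/2}z^{1/2}-q^{-l/2}z^{-1/2}\right).$$ Here square roots $q^{1/2},t^{1/2},u_i^{1/2},v_a^{1/2}$ are fixed arbitrarily, and for a Laurent monomial $z$ in $q,t,u_i,v_a$ the root $z^{1/2}$ denotes the corresponding Laurent monomial in these square roots. -/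

import Mathlib

/-- The `q`-Pochhammer symbol `(z;q)_n = (1 - z)(1 - q z) ⋯ (1 - q^{n-1} z)`. -/
def qPoch (z q : ℂ) (n : ℕ) : ℂ :=
  ∏ m ∈ Finset.range n, (1 - q ^ m * z)

/-- The symmetric `q`-Pochhammer symbol
`[z;q]_n = (z^{1/2} - z^{-1/2}) ⋯ (q^{(n-1)/2} z^{1/2} - q^{-(n-1)/2} z^{-1/2})`,
as a function of the square roots `w = z^{1/2}` and `s = q^{1/2}`. -/
noncomputable def symQPoch (w s : ℂ) (n : ℕ) : ℂ :=
  ∏ m ∈ Finset.range n, (s ^ m * w - (s ^ m)⁻¹ * w⁻¹)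

/-! Put `mob s x = (1 - s x)/(1 - x)`. Up to the factor `t ^ K`, the left summand is the product of
`φ y` over all points `y = q^m u_i`, `m < k_i`, of `n` geometric strings. Here `φ y` is the product
of `mob t⁻¹ (y / q^{k_j} u_j)` over the string ends and of `mob t (y / v_a)` over the `v_a`. The
substitution `(u, v) ↦ (v⁻¹, u⁻¹)` turns the left sum into the right one, so the claim is that this
sum is invariant under it.

The proof is by induction on `K`. For generic parameters, consider the difference of the two sides
as a function of one `u_i`. At `u_i = q^d u_j` only the left side can have poles, and they cancel in
pairs: exchanging the ends of the strings `i` and `j` preserves the points and the ends but reverses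
the sign of the residue (`term_swap`, `tendsto_mul_termSum_string`). At `q^p u_i = v_a` the residue
of each side is a constant times the same side of the identity of degree `K - p - 1` at shifted
variables (`term_shift`). The constant is common to both sides (`shiftCoeff_inv`), so by induction
the residues agree. At `0` and at infinity each factor has a finite limit. By Liouville's theorem
the difference does not depend on `u_i` (`defect_eq`). The variables `u_i` may therefore be moved
one at a time to `t⁻¹ v_i`. There every summand of positive degree on either side contains the
factor `mob t t⁻¹ = 0`, so the difference is zero.

Genericity is removed by continuity along curves that meet the bad set in countably many points,
varying first `u, v`, then `t`, then `q`. -/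

namespace QSource

/-! ### Möbius factors, their leading coefficients at poles, and removable singularities. -/

open Finset Filter Topology

/-- The identity, except that `0` is sent to `1`. -/
noncomputable def reg (x : ℂ) : ℂ := if x = 0 then 1 else x

/-- The quotient `(1 - s x) / (1 - x)`, where a vanishing denominator is dropped. -/
noncomputable def mob (s x : ℂ) : ℂ := (1 - s * x) / reg (1 - x)

lemma reg_zero : reg 0 = 1 := if_pos rfl

lemma reg_of_ne {x : ℂ} (h : x ≠ 0) : reg x = x := if_neg h

lemma mob_of_ne {s x : ℂ} (h : x ≠ 1) : mob s x = (1 - s * x) / (1 - x) := by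
  rw [mob, reg_of_ne (sub_ne_zero.2 h.symm)]

lemma mob_one (s : ℂ) : mob s 1 = 1 - s := by simp [mob, reg_zero]

/-- The case `x = 1` has to be excluded: with the vanishing denominator dropped, the two sides
differ there by a sign. -/
lemma mob_inv {s x : ℂ} (hs : s ≠ 0) (h0 : x ≠ 0) (h1 : x ≠ 1) :
    mob s⁻¹ x⁻¹ = s⁻¹ * mob s x := by
  have h2 : x⁻¹ ≠ 1 := by simpa using h1
  rw [mob_of_ne h1, mob_of_ne h2]
  have h3 : 1 - x ≠ 0 := sub_ne_zero.2 h1.symm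
  have h4 : 1 - x⁻¹ ≠ 0 := sub_ne_zero.2 h2.symm
  have h5 : x - 1 ≠ 0 := sub_ne_zero.2 h1
  field_simp
  ring

lemma differentiableAt_mob {s x : ℂ → ℂ} {z : ℂ} (hs : DifferentiableAt ℂ s z)
    (hx : DifferentiableAt ℂ x z) (h : x z ≠ 1) :
    DifferentiableAt ℂ (fun z => mob (s z) (x z)) z := by
  have h1 : ∀ᶠ y in 𝓝 z, x y ≠ 1 := hx.continuousAt.eventually_ne h
  have h2 : DifferentiableAt ℂ (fun z => (1 - s z * x z) / (1 - x z)) z := by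
    have : 1 - x z ≠ 0 := sub_ne_zero.2 h.symm
    fun_prop (disch := assumption)
  refine h2.congr_of_eventuallyEq ?_
  filter_upwards [h1] with y hy
  exact mob_of_ne hy

section Limits

variable {α : Type*} {X : Finset α} {s r : α → ℂ → ℂ} {z : ℂ}

lemma differentiableAt_prod_mob (hs : ∀ x ∈ X, DifferentiableAt ℂ (s x) z)
    (hr : ∀ x ∈ X, DifferentiableAt ℂ (r x) z) (h : ∀ x ∈ X, r x z ≠ 1) :
    DifferentiableAt ℂ (fun z => ∏ x ∈ X, mob (s x z) (r x z)) z := by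
  have := DifferentiableAt.fun_finsetProd (u := X) (f := fun x z => mob (s x z) (r x z)) (x := z)
    (𝕜 := ℂ) fun x hx => differentiableAt_mob (hs x hx) (hr x hx) (h x hx)
  simpa using this

/-- Since `mob s 1 = 1 - s`, dropping the vanishing denominator makes the value of the product at a
simple pole equal to its leading coefficient there. Residues can thus be compared through values at
the pole itself. -/
lemma tendsto_mul_prod_mob [DecidableEq α] (hs : ∀ x ∈ X, DifferentiableAt ℂ (s x) z)
    (hr : ∀ x ∈ X, DifferentiableAt ℂ (r x) z) {x₀ : α} (h₀ : x₀ ∈ X) (hz : r x₀ z = 1)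
    (h : ∀ x ∈ X, x ≠ x₀ → r x z ≠ 1) (hne : ∀ᶠ y in 𝓝[≠] z, r x₀ y ≠ 1) :
    Tendsto (fun y => (1 - r x₀ y) * ∏ x ∈ X, mob (s x y) (r x y)) (𝓝[≠] z)
      (𝓝 (∏ x ∈ X, mob (s x z) (r x z))) := by
  have h1 : DifferentiableAt ℂ (fun y => (1 - s x₀ y * r x₀ y) *
      ∏ x ∈ X.erase x₀, mob (s x y) (r x y)) z := by
    refine DifferentiableAt.mul ?_ (differentiableAt_prod_mob
      (fun x hx => hs x (mem_of_mem_erase hx)) (fun x hx => hr x (mem_of_mem_erase hx))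
      fun x hx => h x (mem_of_mem_erase hx) (ne_of_mem_erase hx))
    exact (differentiableAt_const _).sub ((hs x₀ h₀).mul (hr x₀ h₀))
  have h2 := h1.continuousAt.tendsto.mono_left (nhdsWithin_le_nhds (s := {z}ᶜ))
  have h3 : (1 - s x₀ z * r x₀ z) * ∏ x ∈ X.erase x₀, mob (s x z) (r x z) =
      ∏ x ∈ X, mob (s x z) (r x z) := by
    rw [← mul_prod_erase X _ h₀]
    simp [hz, mob_one]
  rw [h3] at h2
  refine h2.congr' ?_
  filter_upwards [hne] with y hy
  rw [← mul_prod_erase X _ h₀, mob_of_ne hy]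
  have : 1 - r x₀ y ≠ 0 := sub_ne_zero.2 hy.symm
  field_simp

end Limits

/-- A function with removable singularities at a finite set which has a limit at infinity is
constant. -/
lemma eq_of_removable {F : ℂ → ℂ} {B : Set ℂ} (hB : B.Finite) {L : ℂ}
    (hd : ∀ z ∉ B, DifferentiableAt ℂ F z)
    (hr : ∀ b ∈ B, Tendsto (fun z => (z - b) * F z) (𝓝[≠] b) (𝓝 0))
    (hL : Tendsto F (cocompact ℂ) (𝓝 L)) {z : ℂ} (hz : z ∉ B) : F z = L := by
  classical
  set G : ℂ → ℂ := fun z => if z ∈ B then limUnder (𝓝[≠] z) F else F z with hG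
  have hGF : ∀ z ∉ B, G z = F z := fun z hz => if_neg hz
  have hdG : Differentiable ℂ G := by
    intro b
    by_cases hb : b ∈ B
    · have hcl : IsClosed (B \ {b}) := (hB.subset Set.sdiff_subset).isClosed
      have hV : (B \ {b})ᶜ ∈ 𝓝 b := hcl.isOpen_compl.mem_nhds (by simp)
      have hdo : DifferentiableOn ℂ F ((B \ {b})ᶜ \ {b}) := by
        rintro z ⟨h1, h2⟩
        refine (hd z fun h => h1 ⟨h, h2⟩).differentiableWithinAt
      have ho : (fun z => F z - F b) =o[𝓝[≠] b] fun z => (z - b)⁻¹ := by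
        rw [Asymptotics.isLittleO_iff_tendsto']
        · have h1 := hr b hb
          have h2 : Tendsto (fun z => (z - b) * F b) (𝓝[≠] b) (𝓝 0) := by
            have : Continuous fun z => (z - b) * F b := by fun_prop
            have h3 := (this.tendsto b).mono_left (nhdsWithin_le_nhds (s := {b}ᶜ))
            simpa using h3
          have h3 := h1.sub h2
          rw [sub_zero] at h3
          refine h3.congr fun z => ?_
          rw [div_inv_eq_mul]; ring
        · filter_upwards [self_mem_nhdsWithin] with z hz h
          exact absurd (sub_eq_zero.1 (inv_eq_zero.1 h)) hz
      have := Complex.differentiableOn_update_limUnder_of_isLittleO hV hdo ho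
      have h2 := this.differentiableAt hV
      refine h2.congr_of_eventuallyEq ?_
      filter_upwards [hV] with z hz
      by_cases hzb : z = b
      · subst hzb; simp [hG, hb]
      · rw [Function.update_of_ne hzb, hGF]
        exact fun h => hz ⟨h, hzb⟩
    · refine (hd b hb).congr_of_eventuallyEq ?_
      filter_upwards [hB.isClosed.isOpen_compl.mem_nhds hb] with z hz
      exact hGF z hz
  have hev : ∀ᶠ z in cocompact ℂ, G z = F z := by
    filter_upwards [hB.isCompact.compl_mem_cocompact] with z hz
    exact hGF z hz
  rw [← hGF z hz]
  exact hdG.apply_eq_of_tendsto_cocompact z (hL.congr' (hev.mono fun _ h => h.symm))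

/-- A function that, along a filter, is eventually constant, tends to `0`, or tends to infinity. -/
def Tame (l : Filter ℂ) (f : ℂ → ℂ) : Prop :=
  (∃ c, ∀ᶠ z in l, f z = c) ∨ Tendsto f l (𝓝 0) ∨ Tendsto f l (cocompact ℂ)

/-- As a Möbius map of the sphere, `mob s` has the finite values `1` at `0` and `s` at infinity. An
eventually constant argument is harmless even when the constant is `1`. -/
lemma Tame.exists_tendsto_mob {l : Filter ℂ} {f : ℂ → ℂ} (h : Tame l f) (s : ℂ) :
    ∃ L, Tendsto (fun z => mob s (f z)) l (𝓝 L) := by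
  rcases h with ⟨c, hc⟩ | h | h
  · exact ⟨mob s c, tendsto_const_nhds.congr' (hc.mono fun z hz => by simp only [hz])⟩
  · refine ⟨mob s 0, ?_⟩
    have := (differentiableAt_mob (s := fun _ => s) (x := fun z => z) (z := 0)
      (differentiableAt_const _) differentiableAt_id zero_ne_one).continuousAt.tendsto
    exact this.comp h
  · refine ⟨s, ?_⟩
    have h1 : Tendsto (fun z => (f z)⁻¹) l (𝓝 0) := (tendsto_inv₀_cobounded (α := ℂ)).comp
      (by rwa [Metric.cobounded_eq_cocompact])
    have h2 : Tendsto (fun z => ((f z)⁻¹ - s) / ((f z)⁻¹ - 1)) l (𝓝 ((0 - s) / (0 - 1))) :=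
      (h1.sub_const s).div (h1.sub_const 1) (by norm_num)
    have h3 : ((0 : ℂ) - s) / (0 - 1) = s := by simp
    rw [h3] at h2
    refine h2.congr' ?_
    have h4 : ∀ᶠ z in l, f z ∉ ({0, 1} : Set ℂ) :=
      h.eventually ((Set.toFinite ({0, 1} : Set ℂ)).isCompact.compl_mem_cocompact)
    filter_upwards [h4] with z hz
    simp only [Set.mem_insert_iff, Set.mem_singleton_iff, not_or] at hz
    rw [mob_of_ne hz.2]
    have h5 : (f z)⁻¹ - 1 ≠ 0 := sub_ne_zero.2 (by simpa using hz.2)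
    have h6 : 1 - f z ≠ 0 := sub_ne_zero.2 (Ne.symm hz.2)
    have h7 := hz.1
    field_simp

/-- Two functions that agree off a countable set agree at every common point of continuity. -/
lemma eq_of_eventually_notMem_countable {f g : ℂ → ℂ} {z : ℂ} (hf : ContinuousAt f z)
    (hg : ContinuousAt g z) {S : Set ℂ} (hS : S.Countable)
    (h : ∀ᶠ y in 𝓝 z, y ∉ S → f y = g y) : f z = g z := by
  have hd : Dense Sᶜ := hS.dense_compl ℂ
  have hne : (𝓝[Sᶜ] z).NeBot := mem_closure_iff_nhdsWithin_neBot.1 (hd z)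
  have h1 := hf.tendsto.mono_left (nhdsWithin_le_nhds (s := Sᶜ))
  have h2 := hg.tendsto.mono_left (nhdsWithin_le_nhds (s := Sᶜ))
  refine tendsto_nhds_unique (h1.congr' ?_) h2
  filter_upwards [nhdsWithin_le_nhds h, self_mem_nhdsWithin] with y hy hyS
  exact hy hyS

end QSource

/-! ### Genericity conditions and the summand as a product of Möbius factors. -/

namespace QSource

open Finset Filter Topology

/-- `q` is not a root of unity. -/
def NonRoot (q : ℂ) : Prop := ∀ m : ℕ, 1 ≤ m → q ^ m ≠ 1

/-- The quotient of `a` by `b` is not an integer power of `q`. -/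
def Off (q a b : ℂ) : Prop := ∀ m : ℤ, a ≠ q ^ m * b

lemma NonRoot.zpow_ne_one {q : ℂ} (h : NonRoot q) {m : ℤ} (hm : m ≠ 0) : q ^ m ≠ 1 := by
  obtain ⟨n, rfl | rfl⟩ := m.eq_nat_or_neg
  · rw [zpow_natCast]; exact h n (by omega)
  · rw [zpow_neg, zpow_natCast]
    intro h1
    exact h n (by omega) (inv_eq_one.1 h1)

lemma NonRoot.zpow_mul_ne {q a : ℂ} (h : NonRoot q) (hq : q ≠ 0) (ha : a ≠ 0) {m n : ℤ}
    (hmn : m ≠ n) : q ^ m * a ≠ q ^ n * a := by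
  intro h1
  have h2 := mul_right_cancel₀ ha h1
  apply h.zpow_ne_one (sub_ne_zero.2 hmn)
  rw [zpow_sub₀ hq, h2, div_self (zpow_ne_zero _ hq)]

lemma NonRoot.pow_mul_ne {q a : ℂ} (h : NonRoot q) (hq : q ≠ 0) (ha : a ≠ 0) {m n : ℕ}
    (hmn : m ≠ n) : q ^ m * a ≠ q ^ n * a := by
  have := h.zpow_mul_ne hq ha (m := m) (n := n) (by exact_mod_cast hmn)
  simpa only [zpow_natCast] using this

lemma Off.symm {q a b : ℂ} (hq : q ≠ 0) (h : Off q a b) : Off q b a := by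
  intro m hm
  apply h (-m)
  rw [hm, ← mul_assoc, ← zpow_add₀ hq]; simp

lemma Off.zpow_mul {q a b : ℂ} (hq : q ≠ 0) (h : Off q a b) (n : ℤ) : Off q (q ^ n * a) b := by
  intro m hm
  apply h (m - n)
  rw [zpow_sub₀ hq, div_mul_eq_mul_div, ← hm, mul_div_cancel_left₀ _ (zpow_ne_zero _ hq)]

lemma Off.pow_mul {q a b : ℂ} (hq : q ≠ 0) (h : Off q a b) (n : ℕ) : Off q (q ^ n * a) b := by
  simpa only [zpow_natCast] using h.zpow_mul hq n

lemma Off.ne {q a b : ℂ} (h : Off q a b) : a ≠ b := by simpa using h 0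

lemma Off.pow_mul_ne {q a b : ℂ} (hq : q ≠ 0) (h : Off q a b) (m n : ℕ) :
    q ^ m * a ≠ q ^ n * b :=
  (((h.pow_mul hq m).symm hq).pow_mul hq n).ne.symm

lemma Off.inv {q a b : ℂ} (h : Off q a b) : Off q a⁻¹ b⁻¹ := by
  intro m hm
  apply h (-m)
  rw [← inv_inv a, hm, mul_inv, inv_inv, zpow_neg]

variable {ι : Type*} [Fintype ι]

/-- The summand of the source identity, up to the factor `t ^ |k|`. -/
noncomputable def term (q t : ℂ) (u v : ι → ℂ) (k : ι → ℕ) : ℂ :=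
  ∏ i, ∏ m ∈ range (k i),
    (∏ j, mob t⁻¹ (q ^ m * u i / (q ^ k j * u j))) * ∏ a, mob t (q ^ m * u i / v a)

/-- The sum of all terms of a given total degree. -/
noncomputable def termSum [DecidableEq ι] (K : ℕ) (q t : ℂ) (u v : ι → ℂ) : ℂ :=
  ∑ k ∈ Finset.piAntidiag (Finset.univ : Finset ι) K, term q t u v k

/-- The endpoints of the strings `u j, q u j, …` and the variables `v a`. -/
noncomputable def node (q : ℂ) (u v : ι → ℂ) (k : ι → ℕ) : ι ⊕ ι → ℂ :=
  Sum.elim (fun j => q ^ k j * u j) v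

/-- The parameter attached to a node. -/
noncomputable def nodePar (t : ℂ) : ι ⊕ ι → ℂ := Sum.elim (fun _ => t⁻¹) (fun _ => t)

/-- The index set of all factors of `term`. -/
def slots (k : ι → ℕ) : Finset ((_ : ι) × ℕ × (ι ⊕ ι)) :=
  Finset.univ.sigma fun i => range (k i) ×ˢ Finset.univ

lemma mem_slots {k : ι → ℕ} {x : (_ : ι) × ℕ × (ι ⊕ ι)} : x ∈ slots k ↔ x.2.1 < k x.1 := by
  simp [slots]

lemma term_eq_prod (q t : ℂ) (u v : ι → ℂ) (k : ι → ℕ) :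
    term q t u v k =
      ∏ x ∈ slots k, mob (nodePar t x.2.2) (q ^ x.2.1 * u x.1 / node q u v k x.2.2) := by
  simp only [term, slots, prod_sigma, prod_product, Fintype.prod_sum_type, nodePar, node,
    Sum.elim_inl, Sum.elim_inr]

section Analytic

variable {q t : ℂ → ℂ} {u v : ℂ → ι → ℂ} {z : ℂ} (hq : DifferentiableAt ℂ q z)
  (ht : DifferentiableAt ℂ t z) (hu : ∀ i, DifferentiableAt ℂ (fun y => u y i) z)
  (hv : ∀ i, DifferentiableAt ℂ (fun y => v y i) z) (hq0 : q z ≠ 0) (ht0 : t z ≠ 0)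
  (hu0 : ∀ i, u z i ≠ 0) (hv0 : ∀ i, v z i ≠ 0) (k : ι → ℕ)

omit [Fintype ι] in
lemma node_ne_zero {q : ℂ} {u v : ι → ℂ} (hq0 : q ≠ 0) (hu0 : ∀ i, u i ≠ 0) (hv0 : ∀ i, v i ≠ 0)
    (k : ι → ℕ) (c : ι ⊕ ι) : node q u v k c ≠ 0 := by
  rcases c with j | a
  · exact mul_ne_zero (pow_ne_zero _ hq0) (hu0 j)
  · exact hv0 a

omit [Fintype ι] in
include ht ht0 in
lemma differentiableAt_nodePar (c : ι ⊕ ι) : DifferentiableAt ℂ (fun y => nodePar (t y) c) z := by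
  rcases c with j | a
  · exact ht.inv ht0
  · exact ht

omit [Fintype ι] in
include hq hu hv hq0 hu0 hv0 in
lemma differentiableAt_ratio (x : (_ : ι) × ℕ × (ι ⊕ ι)) : DifferentiableAt ℂ
    (fun y => q y ^ x.2.1 * u y x.1 / node (q y) (u y) (v y) k x.2.2) z := by
  have h1 : DifferentiableAt ℂ (fun y => node (q y) (u y) (v y) k x.2.2) z := by
    rcases x.2.2 with j | a
    · exact (hq.pow _).mul (hu j)
    · exact hv a
  exact ((hq.pow _).mul (hu _)).div h1 (node_ne_zero hq0 hu0 hv0 k _)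

include hq ht hu hv hq0 ht0 hu0 hv0 in
lemma differentiableAt_term
    (h : ∀ i m c, m < k i → q z ^ m * u z i ≠ node (q z) (u z) (v z) k c) :
    DifferentiableAt ℂ (fun y => term (q y) (t y) (u y) (v y) k) z := by
  simp only [term_eq_prod]
  refine differentiableAt_prod_mob (fun x _ => differentiableAt_nodePar ht ht0 _)
    (fun x _ => differentiableAt_ratio hq hu hv hq0 hu0 hv0 k x) fun x hx => ?_
  rw [Ne, div_eq_one_iff_eq (node_ne_zero hq0 hu0 hv0 k _)]
  exact h _ _ _ (mem_slots.1 hx)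

end Analytic

section Residue

variable {q t : ℂ} {u v : ℂ → ι → ℂ} {z : ℂ} (hu : ∀ i, DifferentiableAt ℂ (fun y => u y i) z)
  (hv : ∀ i, DifferentiableAt ℂ (fun y => v y i) z) (hq0 : q ≠ 0) (ht0 : t ≠ 0)
  (hu0 : ∀ i, u z i ≠ 0) (hv0 : ∀ i, v z i ≠ 0) (k : ι → ℕ)

include hu hv hq0 hu0 hv0 in
lemma tendsto_mul_term [DecidableEq ι] {i : ι} {m : ℕ} {c : ι ⊕ ι} (hm : m < k i)
    (hz : q ^ m * u z i = node q (u z) (v z) k c)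
    (h : ∀ i' m' c', m' < k i' → q ^ m' * u z i' = node q (u z) (v z) k c' →
      i' = i ∧ m' = m ∧ c' = c)
    (hne : ∀ᶠ y in 𝓝[≠] z, q ^ m * u y i / node q (u y) (v y) k c ≠ 1) :
    Tendsto (fun y => (1 - q ^ m * u y i / node q (u y) (v y) k c) * term q t (u y) (v y) k)
      (𝓝[≠] z) (𝓝 (term q t (u z) (v z) k)) := by
  have key := tendsto_mul_prod_mob (X := slots k) (z := z) (x₀ := ⟨i, m, c⟩)
    (r := fun x y => q ^ x.2.1 * u y x.1 / node q (u y) (v y) k x.2.2)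
    (s := fun x _ => nodePar t x.2.2)
    (fun x _ => differentiableAt_const _)
    (fun x _ => differentiableAt_ratio (differentiableAt_const _) hu hv hq0 hu0 hv0 k x)
    (mem_slots.2 hm) (by simp only [hz]; exact div_self (node_ne_zero hq0 hu0 hv0 k _)) ?_ hne
  · simp only [term_eq_prod]
    exact key
  · rintro ⟨i', m', c'⟩ hx hne' h1
    rw [div_eq_one_iff_eq (node_ne_zero hq0 hu0 hv0 k _)] at h1
    obtain ⟨rfl, rfl, rfl⟩ := h _ _ _ (mem_slots.1 hx) h1
    exact hne' rfl

include hu hv hq0 ht0 hu0 hv0 in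
lemma tendsto_mul_term_zero {f : ℂ → ℂ} (hf : Tendsto f (𝓝[≠] z) (𝓝 0))
    (h : ∀ i m c, m < k i → q ^ m * u z i ≠ node q (u z) (v z) k c) :
    Tendsto (fun y => f y * term q t (u y) (v y) k) (𝓝[≠] z) (𝓝 0) := by
  have h1 := (differentiableAt_term (differentiableAt_const q) (differentiableAt_const t) hu hv hq0
    ht0 hu0 hv0 k h).continuousAt.tendsto.mono_left (nhdsWithin_le_nhds (s := {z}ᶜ))
  simpa using hf.mul h1

end Residue

lemma exists_tendsto_term (q t : ℂ) {u v : ℂ → ι → ℂ} (k : ι → ℕ) {l : Filter ℂ}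
    (h : ∀ i m c, Tame l fun y => q ^ m * u y i / node q (u y) (v y) k c) :
    ∃ L, Tendsto (fun y => term q t (u y) (v y) k) l (𝓝 L) := by
  simp only [term_eq_prod]
  choose L hL using fun x : (_ : ι) × ℕ × (ι ⊕ ι) =>
    (h x.1 x.2.1 x.2.2).exists_tendsto_mob (nodePar t x.2.2)
  exact ⟨_, tendsto_finsetProd _ fun x _ => hL x⟩

end QSource

/-! ### Cancellation of the poles at `u i = q ^ d * u j`. -/

namespace QSource

open Finset Filter Topology

/-- The integer intervals `[d, d + a)` and `[0, b)` exchange right ends to become `[d, b)` and `[0,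
d + a)`; the points are covered with the same multiplicities. -/
lemma prod_range_mul_prod_range_swap (g : ℤ → ℂ) {d : ℤ} {a b a' b' : ℕ} (ha : (a' : ℤ) = b - d)
    (hb : (b' : ℤ) = a + d) :
    (∏ m ∈ range a, g (d + m)) * ∏ m ∈ range b, g m =
      (∏ m ∈ range a', g (d + m)) * ∏ m ∈ range b', g m := by
  obtain ⟨n, rfl | rfl⟩ := d.eq_nat_or_neg
  · obtain rfl : b = n + a' := by omega
    obtain rfl : b' = n + a := by omega
    simp only [prod_range_add, Nat.cast_add]
    ring
  · obtain rfl : a = n + b' := by omega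
    obtain rfl : a' = n + b := by omega
    simp only [prod_range_add, Nat.cast_add, neg_add_cancel_left]
    ring

variable {ι : Type*} [Fintype ι] [DecidableEq ι]

lemma prod_eq_mul_mul_prod_erase {i j : ι} (hij : i ≠ j) (f : ι → ℂ) :
    ∏ l, f l = f i * f j * ∏ l ∈ (univ.erase i).erase j, f l := by
  rw [← mul_prod_erase univ f (mem_univ i),
    ← mul_prod_erase (univ.erase i) f (mem_erase.2 ⟨hij.symm, mem_univ j⟩), mul_assoc]

/-- When `u i` and `u j` lie on one geometric progression, exchanging the ends of their strings
permutes the set of ends, hence fixes `φ`, and also keeps the multiset of points over which `φ` is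
multiplied. The equality holds at the pole itself because `mob` is total. -/
lemma term_swap {q t : ℂ} {u v : ι → ℂ} (hq : q ≠ 0) {i j : ι} (hij : i ≠ j) {d : ℤ}
    (hu : u i = q ^ d * u j) {k k' : ι → ℕ} (hi : (k' i : ℤ) = k j - d)
    (hj : (k' j : ℤ) = k i + d) (hl : ∀ l, l ≠ i → l ≠ j → k' l = k l) :
    term q t u v k' = term q t u v k := by
  have hend : ∀ l, q ^ k' (Equiv.swap i j l) * u (Equiv.swap i j l) = q ^ k l * u l := by
    intro l
    by_cases h1 : l = i
    · subst h1
      rw [Equiv.swap_apply_left, hu, ← mul_assoc, ← zpow_natCast, ← zpow_natCast,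
        ← zpow_add₀ hq, hj]
    by_cases h2 : l = j
    · subst h2
      rw [Equiv.swap_apply_right, hu, ← mul_assoc, ← zpow_natCast, ← zpow_natCast,
        ← zpow_add₀ hq, hi, sub_add_cancel]
    rw [Equiv.swap_apply_of_ne_of_ne h1 h2, hl l h1 h2]
  have hphi : ∀ y, ∏ l, mob t⁻¹ (y / (q ^ k' l * u l)) = ∏ l, mob t⁻¹ (y / (q ^ k l * u l)) := by
    intro y
    rw [← Equiv.prod_comp (Equiv.swap i j)]
    simp only [hend]
  simp only [term, hphi]
  set φ : ℂ → ℂ := fun y => (∏ l, mob t⁻¹ (y / (q ^ k l * u l))) * ∏ a, mob t (y / v a) with hφ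
  change ∏ l, ∏ m ∈ range (k' l), φ (q ^ m * u l) = ∏ l, ∏ m ∈ range (k l), φ (q ^ m * u l)
  have h3 : ∀ m : ℕ, φ (q ^ m * u i) = φ (q ^ (d + m : ℤ) * u j) := by
    intro m
    rw [hu, ← mul_assoc, add_comm d, zpow_add₀ hq, zpow_natCast]
  have h4 : ∀ m : ℕ, φ (q ^ m * u j) = φ (q ^ (m : ℤ) * u j) := by
    intro m
    rw [zpow_natCast]
  rw [prod_eq_mul_mul_prod_erase hij, prod_eq_mul_mul_prod_erase hij]
  congr 1
  · simp only [h3, h4]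
    exact (prod_range_mul_prod_range_swap (fun n => φ (q ^ n * u j)) hi hj).symm
  · refine prod_congr rfl fun l hl' => ?_
    simp only [mem_erase, mem_univ, and_true] at hl'
    rw [hl l hl'.2 hl'.1]

omit [Fintype ι] [DecidableEq ι] in
/-- Where the denominators vanish when `u i = q ^ d * u j` and all else is generic. -/
lemma eq_of_mul_eq_node {q : ℂ} {u v : ι → ℂ} (hq : q ≠ 0) (hr : NonRoot q) (hu0 : ∀ l, u l ≠ 0)
    {i j : ι} {d : ℤ} (hu : u i = q ^ d * u j)
    (huu : ∀ l b, l ≠ b → l ≠ i → b ≠ i → Off q (u l) (u b))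
    (huv : ∀ l a, l ≠ i → Off q (u l) (v a)) (hij : i ≠ j) {k : ι → ℕ} {l : ι} {m : ℕ} {c : ι ⊕ ι}
    (hm : m < k l) (h : q ^ m * u l = node q u v k c) :
    (l = i ∧ c = Sum.inl j ∧ (m : ℤ) = k j - d) ∨
      (l = j ∧ c = Sum.inl i ∧ (m : ℤ) = k i + d) := by
  rcases c with b | a
  · change q ^ m * u l = q ^ k b * u b at h
    by_cases hlb : l = b
    · subst hlb
      exact absurd h (hr.pow_mul_ne hq (hu0 l) hm.ne)
    by_cases hli : l = i
    · subst hli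
      by_cases hbj : b = j
      · subst hbj
        refine Or.inl ⟨rfl, rfl, ?_⟩
        by_contra hne
        rw [hu, ← mul_assoc, ← zpow_natCast, ← zpow_natCast, ← zpow_add₀ hq] at h
        exact hr.zpow_mul_ne hq (hu0 b) (by omega) h
      · rw [hu] at h
        have := (huu j b (Ne.symm hbj) hij.symm (Ne.symm hlb)).zpow_mul hq d
        exact absurd h (this.pow_mul_ne hq _ _)
    by_cases hbi : b = i
    · subst hbi
      by_cases hlj : l = j
      · subst hlj
        refine Or.inr ⟨rfl, rfl, ?_⟩
        by_contra hne
        rw [hu, ← mul_assoc, ← zpow_natCast, ← zpow_natCast, ← zpow_add₀ hq] at h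
        exact hr.zpow_mul_ne hq (hu0 l) (by omega) h
      · rw [hu] at h
        have := ((huu j l (Ne.symm hlj) hij.symm hli).zpow_mul hq d).symm hq
        exact absurd h (this.pow_mul_ne hq _ _)
    exact absurd h ((huu l b hlb hli hbi).pow_mul_ne hq _ _)
  · change q ^ m * u l = v a at h
    by_cases hli : l = i
    · subst hli
      rw [hu] at h
      have := (((huv j a hij.symm).zpow_mul hq d).pow_mul hq m).ne
      exact absurd h this
    · exact absurd h ((huv l a hli).pow_mul hq m).ne

/-- The sign of the residue of `term` at `u i = q ^ d * u j`. -/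
def poleSign (i j : ι) (d : ℤ) (k : ι → ℕ) : ℤ :=
  if 0 ≤ k j - d ∧ k j - d < k i then 1 else if 0 ≤ k i + d ∧ k i + d < k j then -1 else 0

/-- The involution on exponents that pairs terms with opposite residues. -/
def swapEnds (i j : ι) (d : ℤ) (k : ι → ℕ) : ι → ℕ :=
  if 0 ≤ k j - d ∧ 0 ≤ k i + d then
    Function.update (Function.update k i (k j - d).toNat) j (k i + d).toNat else k

section SwapEnds

variable {i j : ι} {d : ℤ} {k : ι → ℕ}

omit [Fintype ι]

lemma swapEnds_of_not (h : ¬(0 ≤ k j - d ∧ 0 ≤ k i + d)) : swapEnds i j d k = k := if_neg h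

lemma swapEnds_left (hij : i ≠ j) (h : 0 ≤ k j - d ∧ 0 ≤ k i + d) :
    (swapEnds i j d k i : ℤ) = k j - d := by
  simp only [swapEnds, if_pos h, Function.update_of_ne hij, Function.update_self]; omega

lemma swapEnds_right (h : 0 ≤ k j - d ∧ 0 ≤ k i + d) : (swapEnds i j d k j : ℤ) = k i + d := by
  simp only [swapEnds, if_pos h, Function.update_self]; omega

lemma swapEnds_of_ne {l : ι} (hi : l ≠ i) (hj : l ≠ j) : swapEnds i j d k l = k l := by
  unfold swapEnds
  split_ifs
  · rw [Function.update_of_ne hj, Function.update_of_ne hi]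
  · rfl

end SwapEnds

section

variable {q t : ℂ} {u v : ι → ℂ} (hq : q ≠ 0) (ht : t ≠ 0) (hr : NonRoot q) (hu0 : ∀ l, u l ≠ 0)
  (hv0 : ∀ a, v a ≠ 0) {i j : ι} (hij : i ≠ j)
  (huu : ∀ l b, l ≠ b → l ≠ i → b ≠ i → Off q (u l) (u b))
  (huv : ∀ l a, l ≠ i → Off q (u l) (v a)) (d : ℤ)

omit [Fintype ι] in
lemma differentiable_update (i l : ι) : Differentiable ℂ fun z => Function.update u i z l := by
  by_cases h : l = i
  · subst h; simp
  · simp [Function.update_of_ne h]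

-- A pole occurs when the end of one of the strings `i`, `j` is a point of the other. The two
-- possibilities need `k j < k i + d` and `k i + d < k j` respectively, so at most one factor is
-- singular.
include hq ht hr hu0 hv0 hij huu huv in
lemma tendsto_mul_term_string (k : ι → ℕ) :
    Tendsto (fun z => (1 - z / (q ^ d * u j)) * term q t (Function.update u i z) v k)
      (𝓝[≠] (q ^ d * u j)) (𝓝 (poleSign i j d k *
        term q t (Function.update u i (q ^ d * u j)) v k)) := by
  set β := q ^ d * u j with hβ
  have hβ0 : β ≠ 0 := mul_ne_zero (zpow_ne_zero _ hq) (hu0 j)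
  have hU0 : ∀ l, Function.update u i β l ≠ 0 := by
    intro l
    by_cases h : l = i
    · subst h; simpa using hβ0
    · simpa [Function.update_of_ne h] using hu0 l
  have hcl := fun {l m c} (hm : m < k l) => eq_of_mul_eq_node (v := v) (l := l) (m := m) (c := c)
    (i := i) (j := j) (d := d) (k := k) hq hr hU0
    (by simp [Function.update_of_ne hij.symm, hβ])
    (fun l b h1 h2 h3 => by simpa [h2, h3] using huu l b h1 h2 h3)
    (fun l a h => by simpa [h] using huv l a h) hij hm
  have hf : Tendsto (fun z => 1 - z / β) (𝓝[≠] β) (𝓝 0) := by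
    have : Continuous fun z => 1 - z / β := by fun_prop
    simpa [hβ0] using (this.tendsto β).mono_left (nhdsWithin_le_nhds (s := {β}ᶜ))
  have hne : ∀ᶠ z in 𝓝[≠] β, z / β ≠ 1 := by
    filter_upwards [self_mem_nhdsWithin] with z hz h
    exact hz ((div_eq_one_iff_eq hβ0).1 h)
  unfold poleSign
  split_ifs with h1 h2
  · obtain ⟨m, hm⟩ : ∃ m : ℕ, (m : ℤ) = k j - d := ⟨(k j - d).toNat, by omega⟩
    have hpow : q ^ k j = q ^ m * q ^ d := by
      rw [← zpow_natCast, ← zpow_natCast, ← zpow_add₀ hq, hm, sub_add_cancel]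
    have hrat : ∀ z, q ^ m * Function.update u i z i /
        node q (Function.update u i z) v k (Sum.inl j) = z / β := by
      intro z
      simp only [node, Sum.elim_inl, Function.update_self, Function.update_of_ne hij.symm]
      rw [hpow, mul_assoc, mul_div_mul_left _ _ (pow_ne_zero _ hq)]
    have key := tendsto_mul_term (t := t) (u := Function.update u i) (v := fun _ => v)
      (z := β) (fun l => (differentiable_update i l).differentiableAt)
      (fun l => differentiableAt_const _) hq hU0 hv0 k (i := i) (m := m) (c := Sum.inl j)
      (by omega) (by
        rw [← div_eq_one_iff_eq (node_ne_zero hq hU0 hv0 k _), hrat, div_self hβ0])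
      (fun l m' c h3 h4 => by
        rcases hcl h3 h4 with ⟨rfl, rfl, h5⟩ | ⟨rfl, rfl, h5⟩
        · exact ⟨rfl, by omega, rfl⟩
        · omega)
      (by simpa only [hrat] using hne)
    simpa only [hrat, Int.cast_one, one_mul] using key
  · obtain ⟨m, hm⟩ : ∃ m : ℕ, (m : ℤ) = k i + d := ⟨(k i + d).toNat, by omega⟩
    have hpow : q ^ m = q ^ k i * q ^ d := by
      rw [← zpow_natCast, ← zpow_natCast, ← zpow_add₀ hq, hm]
    have hrat : ∀ z, q ^ m * Function.update u i z j /
        node q (Function.update u i z) v k (Sum.inl i) = β / z := by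
      intro z
      simp only [node, Sum.elim_inl, Function.update_self, Function.update_of_ne hij.symm]
      rw [hpow, mul_assoc, mul_div_mul_left _ _ (pow_ne_zero _ hq)]
    have key := tendsto_mul_term (t := t) (u := Function.update u i) (v := fun _ => v)
      (z := β) (fun l => (differentiable_update i l).differentiableAt)
      (fun l => differentiableAt_const _) hq hU0 hv0 k (i := j) (m := m) (c := Sum.inl i)
      (by omega) (by
        rw [← div_eq_one_iff_eq (node_ne_zero hq hU0 hv0 k _), hrat, div_self hβ0])
      (fun l m' c h3 h4 => by
        rcases hcl h3 h4 with ⟨rfl, rfl, h5⟩ | ⟨rfl, rfl, h5⟩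
        · omega
        · exact ⟨rfl, by omega, rfl⟩)
      (by
        simp only [hrat]
        filter_upwards [hne] with z hz h
        rw [← inv_div, inv_eq_one] at h
        exact hz h)
    simp only [hrat] at key
    -- The singular factor now has argument `β / z`, and `1 - z / β = -(z / β) * (1 - β / z)`; this
    -- produces the sign `-1`.
    have h3 : Tendsto (fun z => -(z / β)) (𝓝[≠] β) (𝓝 (-1)) := by
      have : Continuous fun z => -(z / β) := by fun_prop
      simpa [hβ0] using (this.tendsto β).mono_left (nhdsWithin_le_nhds (s := {β}ᶜ))
    have h4 := h3.mul key
    push_cast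
    refine h4.congr' ?_
    have h5 : ∀ᶠ z in 𝓝[≠] β, z ≠ 0 :=
      nhdsWithin_le_nhds (continuousAt_id.eventually_ne hβ0)
    filter_upwards [h5] with z hz
    rw [← mul_assoc]
    congr 1
    field_simp
    ring
  · simp only [Int.cast_zero, zero_mul]
    refine tendsto_mul_term_zero (u := Function.update u i) (v := fun _ => v)
      (fun l => (differentiable_update i l).differentiableAt)
      (fun l => differentiableAt_const _) hq ht hU0 hv0 k hf fun l m c h3 h4 => ?_
    rcases hcl h3 h4 with ⟨rfl, rfl, h5⟩ | ⟨rfl, rfl, h5⟩ <;> omega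

-- The exchange of ends is an involution on the exponents of total degree `K`; it preserves the
-- value of `term` at the pole and negates `poleSign`, so the residues sum to zero.
include hq ht hr hu0 hv0 hij huu huv in
lemma tendsto_mul_termSum_string (K : ℕ) :
    Tendsto (fun z => (1 - z / (q ^ d * u j)) * termSum K q t (Function.update u i z) v)
      (𝓝[≠] (q ^ d * u j)) (𝓝 0) := by
  have key := tendsto_finsetSum (piAntidiag (univ : Finset ι) K) fun k (_ : k ∈ piAntidiag univ K) =>
    tendsto_mul_term_string hq ht hr hu0 hv0 hij huu huv d k
  simp only [← mul_sum] at key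
  suffices h : ∑ k ∈ piAntidiag (univ : Finset ι) K, (poleSign i j d k : ℂ) *
      term q t (Function.update u i (q ^ d * u j)) v k = 0 by
    rw [h] at key
    exact key
  refine sum_involution (fun k _ => swapEnds i j d k) ?_ ?_ ?_ ?_
  · intro k _
    by_cases h : 0 ≤ k j - d ∧ 0 ≤ k i + d
    · have hi := swapEnds_left hij h
      have hj := swapEnds_right h
      rw [term_swap hq hij (d := d) (by simp [Function.update_of_ne hij.symm]) hi hj
        fun l => swapEnds_of_ne, ← add_mul]
      have : poleSign i j d k + poleSign i j d (swapEnds i j d k) = 0 := by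
        unfold poleSign
        rw [hi, hj]
        split_ifs <;> omega
      rw [← Int.cast_add, this]; simp
    · have : poleSign i j d k = 0 := by
        unfold poleSign; split_ifs <;> omega
      simp only [swapEnds_of_not h, this, Int.cast_zero, zero_mul, add_zero]
  -- A fixed point of a genuine exchange has `k i = k j - d`, so neither strict inequality in
  -- `poleSign` holds.
  · intro k _ hk h
    apply hk
    have : poleSign i j d k = 0 := by
      unfold poleSign
      by_cases h' : 0 ≤ k j - d ∧ 0 ≤ k i + d
      · have hi := swapEnds_left hij h'
        rw [h] at hi
        split_ifs <;> omega
      · split_ifs <;> omega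
    simp [this]
  · intro k hk
    rw [mem_piAntidiag] at hk ⊢
    refine ⟨?_, by simp⟩
    rw [← hk.1]
    by_cases h : 0 ≤ k j - d ∧ 0 ≤ k i + d
    · have hs : ∀ f : ι → ℕ, univ.sum f = f i + f j + ∑ l ∈ (univ.erase i).erase j, f l := by
        intro f
        rw [← add_sum_erase univ f (mem_univ i),
          ← add_sum_erase (univ.erase i) f (mem_erase.2 ⟨hij.symm, mem_univ j⟩), add_assoc]
      rw [hs, hs k]
      have hi := swapEnds_left hij h
      have hj := swapEnds_right h
      congr 1
      · omega
      · refine sum_congr rfl fun l hl => ?_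
        simp only [mem_erase, mem_univ, and_true] at hl
        exact swapEnds_of_ne hl.2 hl.1
    · rw [swapEnds_of_not h]
  · intro k _
    by_cases h : 0 ≤ k j - d ∧ 0 ≤ k i + d
    · have hi := swapEnds_left hij h
      have hj := swapEnds_right h
      have h' : 0 ≤ (swapEnds i j d k j : ℤ) - d ∧ 0 ≤ (swapEnds i j d k i : ℤ) + d := by omega
      have hi' := swapEnds_left hij h'
      have hj' := swapEnds_right h'
      funext l
      by_cases h2 : l = j
      · subst h2; omega
      by_cases h1 : l = i
      · subst h1; omega
      rw [swapEnds_of_ne h1 h2, swapEnds_of_ne h1 h2]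
    · simp only [swapEnds_of_not h]

end

end QSource

/-! ### Residues at `q ^ p * u i = v a` and reduction of the degree. -/

namespace QSource

open Finset Filter Topology

/-- The product of `f` over the string `x, q x, …, q ^ (k - 1) x`. -/
noncomputable def strProd (q : ℂ) (f : ℂ → ℂ) (k : ℕ) (x : ℂ) : ℂ :=
  ∏ m ∈ range k, f (q ^ m * x)

lemma strProd_add (q : ℂ) (f : ℂ → ℂ) (a b : ℕ) (x : ℂ) :
    strProd q f (a + b) x = strProd q f a x * strProd q f b (q ^ a * x) := by
  simp only [strProd, prod_range_add]
  congr 1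
  refine prod_congr rfl fun m _ => ?_
  rw [← mul_assoc, ← pow_add, add_comm a]

lemma strProd_comp_mul (q : ℂ) (f : ℂ → ℂ) (k s : ℕ) (x : ℂ) :
    strProd q (fun y => f (q ^ s * y)) k x = strProd q f k (q ^ s * x) := by
  simp only [strProd]
  refine prod_congr rfl fun m _ => ?_
  congr 1; ring

variable {ι : Type*} [Fintype ι]

lemma term_eq_strProd (q t : ℂ) (u v : ι → ℂ) (k : ι → ℕ) :
    term q t u v k =
      (∏ j, ∏ l, strProd q (fun y => mob t⁻¹ (y / (q ^ k j * u j))) (k l) (u l)) *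
        ∏ b, ∏ l, strProd q (fun y => mob t (y / v b)) (k l) (u l) := by
  simp only [term, strProd, prod_mul_distrib]
  congr 1
  · rw [Finset.prod_comm]
    exact prod_congr rfl fun _ _ => Finset.prod_comm
  · rw [Finset.prod_comm]
    exact prod_congr rfl fun _ _ => Finset.prod_comm

variable [DecidableEq ι]

lemma prod_strProd_shift (q : ℂ) (f : ℂ → ℂ) {u u' : ι → ℂ} {k k' : ι → ℕ} {i : ι} {s : ℕ}
    (hu : u' = Function.update u i (q ^ s * u i)) (hk : k = Function.update k' i (s + k' i)) :
    ∏ l, strProd q f (k l) (u l) = strProd q f s (u i) * ∏ l, strProd q f (k' l) (u' l) := by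
  rw [← mul_prod_erase univ _ (mem_univ i),
    ← mul_prod_erase univ (fun l => strProd q f (k' l) (u' l)) (mem_univ i), ← mul_assoc]
  congr 1
  · simp only [hu, hk, Function.update_self, strProd_add]
  · refine prod_congr rfl fun l hl => ?_
    have := ne_of_mem_erase hl
    rw [hu, hk, Function.update_of_ne this, Function.update_of_ne this]

/-- The constant by which a residue of the source identity differs from an identity of lower
degree. -/
noncomputable def shiftCoeff (q t : ℂ) (p : ℕ) (u v : ι → ℂ) (i a : ι) : ℂ :=
  (t⁻¹ ^ (p + 1)) ^ Fintype.card ι *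
    (∏ b ∈ univ.erase a, strProd q (mob t) (p + 1) (u i / v b)) *
    (∏ l ∈ univ.erase i, strProd q (mob t) (p + 1) (u l / v a)) *
    strProd q (mob t) (p + 1 + (p + 1)) (u i / v a)

/-- The coefficient depends only on the ratios `u / v`; the duality exchanges its two products over
erased index sets. This is why both sides of the source identity have the same residue constant. -/
lemma shiftCoeff_inv (q t : ℂ) (p : ℕ) (u v : ι → ℂ) (i a : ι) :
    shiftCoeff q t p v⁻¹ u⁻¹ a i = shiftCoeff q t p u v i a := by
  simp only [shiftCoeff, Pi.inv_apply, inv_div_inv]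
  ring

lemma strProd_div (q t : ℂ) (k : ℕ) (x w : ℂ) :
    strProd q (fun y => mob t (y / w)) k x = strProd q (mob t) k (x / w) := by
  simp only [strProd, mul_div_assoc]

/-- Reading the string from `x` to `y` backwards inverts the ratios, and `mob_inv` applies to each
factor. A string based at `x` and compared with `w` becomes a string based at `w` and compared with
`y`. -/
lemma strProd_reflect {q t : ℂ} (hq : q ≠ 0) (ht : t ≠ 0) {p : ℕ} {x w y : ℂ} (hy : y = q ^ p * x)
    (hw0 : w ≠ 0) (hx0 : x ≠ 0) (hw : ∀ m ≤ p, q ^ m * w ≠ y) :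
    strProd q (fun z => mob t⁻¹ (z / w)) (p + 1) x =
      t⁻¹ ^ (p + 1) * strProd q (fun z => mob t (z / y)) (p + 1) w := by
  have hy0 : y ≠ 0 := by rw [hy]; exact mul_ne_zero (pow_ne_zero _ hq) hx0
  have h1 : t⁻¹ ^ (p + 1) = ∏ _m ∈ range (p + 1), t⁻¹ := by simp
  rw [strProd, ← prod_range_reflect, h1, strProd, ← prod_mul_distrib]
  refine prod_congr rfl fun m hm => ?_
  have hm' : m ≤ p := Nat.lt_succ_iff.1 (mem_range.1 hm)
  have h2 : q ^ (p + 1 - 1 - m) * x / w = (q ^ m * w / y)⁻¹ := by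
    have : q ^ (p + 1 - 1 - m) * q ^ m = q ^ p := by rw [← pow_add]; congr 1; omega
    rw [inv_div, hy, ← this]
    have := pow_ne_zero m hq
    field_simp
  rw [h2, mob_inv ht]
  · exact div_ne_zero (mul_ne_zero (pow_ne_zero _ hq) hw0) hy0
  · rw [Ne, div_eq_one_iff_eq hy0]; exact hw m hm'

/-- Cutting the first `p + 1` points off string `i` leaves all ends in place. By reflection, the
removed factors prolong each string by `p + 1` points in the product of `mob t (y / v a)`. Replacing
`v a` by `q^{-(p+1)} v a` absorbs this prolongation, up to initial segments that do not depend on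
`k`. -/
lemma term_shift {q t : ℂ} (hq : q ≠ 0) (ht : t ≠ 0) {u v u' v' : ι → ℂ} {k k' : ι → ℕ}
    {i a : ι} {p : ℕ} (hu0 : ∀ l, u l ≠ 0) (hva : v a = q ^ p * u i)
    (hu : u' = Function.update u i (q ^ (p + 1) * u i))
    (hv : v' = Function.update v a ((q ^ (p + 1))⁻¹ * v a))
    (hk : k = Function.update k' i (p + 1 + k' i))
    (hw : ∀ l, ∀ m ≤ p, q ^ m * (q ^ k l * u l) ≠ v a) :
    term q t u v k = shiftCoeff q t p u v i a * term q t u' v' k' := by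
  have hend : ∀ l, q ^ k' l * u' l = q ^ k l * u l := by
    intro l
    by_cases h : l = i
    · subst h
      simp only [hu, hk, Function.update_self]
      ring
    · simp only [hu, hk, Function.update_of_ne h]
  have hγ : ∀ y, mob t (y / v' a) = mob t (q ^ (p + 1) * y / v a) := by
    intro y
    have := pow_ne_zero (p + 1) hq
    rw [hv, Function.update_self]
    congr 1
    have hva0 : v a ≠ 0 := by rw [hva]; exact mul_ne_zero (pow_ne_zero _ hq) (hu0 i)
    field_simp
  have hβ : ∀ b ∈ univ.erase a, v' b = v b := fun b hb => by
    rw [hv, Function.update_of_ne (ne_of_mem_erase hb)]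
  set γ : ℂ → ℂ := fun y => mob t (y / v a) with hγdef
  -- For `l ≠ i` the prolonged string splits into `p + 1` initial points and the shifted string of
  -- length `k' l`. For `l = i` the initial segment has `2 (p + 1)` points, because `u' i` is itself
  -- shifted by `p + 1`.
  have hlast : (∏ l, strProd q γ (p + 1) (q ^ k l * u l)) * ∏ l, strProd q γ (k l) (u l) =
      (∏ l ∈ univ.erase i, strProd q γ (p + 1) (u l)) * strProd q γ (p + 1 + (p + 1)) (u i) *
        ∏ l, strProd q (fun y => mob t (y / v' a)) (k' l) (u' l) := by
    rw [← prod_mul_distrib, ← mul_prod_erase univ _ (mem_univ i),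
      ← mul_prod_erase univ (fun l => strProd q (fun y => mob t (y / v' a)) (k' l) (u' l))
        (mem_univ i)]
    have h1 : strProd q γ (p + 1) (q ^ k i * u i) * strProd q γ (k i) (u i) =
        strProd q γ (p + 1 + (p + 1)) (u i) *
          strProd q (fun y => mob t (y / v' a)) (k' i) (u' i) := by
      simp only [hγ]
      rw [strProd_comp_mul q γ, mul_comm, ← strProd_add, hu, Function.update_self, ← mul_assoc,
        ← pow_add, ← strProd_add, hk, Function.update_self]
      congr 1
      omega
    have h2 : ∏ l ∈ univ.erase i, strProd q γ (p + 1) (q ^ k l * u l) * strProd q γ (k l) (u l) =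
        (∏ l ∈ univ.erase i, strProd q γ (p + 1) (u l)) *
          ∏ l ∈ univ.erase i, strProd q (fun y => mob t (y / v' a)) (k' l) (u' l) := by
      rw [← prod_mul_distrib]
      refine prod_congr rfl fun l hl => ?_
      have hl' := ne_of_mem_erase hl
      simp only [hγ]
      rw [strProd_comp_mul q γ, mul_comm, ← strProd_add, hu, hk, Function.update_of_ne hl',
        Function.update_of_ne hl', ← strProd_add, add_comm]
    rw [h1, h2]
    ring
  have hrefl : ∏ j, strProd q (fun y => mob t⁻¹ (y / (q ^ k j * u j))) (p + 1) (u i) =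
      (t⁻¹ ^ (p + 1)) ^ Fintype.card ι * ∏ l, strProd q γ (p + 1) (q ^ k l * u l) := by
    rw [← Finset.card_univ, ← prod_const, ← prod_mul_distrib]
    exact prod_congr rfl fun l _ => strProd_reflect hq ht hva
      (mul_ne_zero (pow_ne_zero _ hq) (hu0 l)) (hu0 i) (hw l)
  rw [term_eq_strProd, term_eq_strProd]
  simp only [hend]
  simp only [prod_strProd_shift q (fun y => mob t⁻¹ (y / _)) hu hk]
  rw [prod_mul_distrib, hrefl, ← mul_prod_erase univ (fun b => ∏ l, strProd q
    (fun y => mob t (y / v b)) (k l) (u l)) (mem_univ a)]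
  have hmid : ∏ b ∈ univ.erase a, ∏ l, strProd q (fun y => mob t (y / v b)) (k l) (u l) =
      (∏ b ∈ univ.erase a, strProd q (mob t) (p + 1) (u i / v b)) *
      ∏ b ∈ univ.erase a, ∏ l, strProd q (fun y => mob t (y / v' b)) (k' l) (u' l) := by
    rw [← prod_mul_distrib]
    refine prod_congr rfl fun b hb => ?_
    rw [hβ b hb, prod_strProd_shift q _ hu hk, strProd_div]
  rw [hmid, ← mul_prod_erase univ (fun b => ∏ l, strProd q
    (fun y => mob t (y / v' b)) (k' l) (u' l)) (mem_univ a), shiftCoeff]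
  simp only [← strProd_div q t _ _ (v a)]
  rw [hγdef] at hlast
  linear_combination (t⁻¹ ^ (p + 1)) ^ Fintype.card ι *
    (∏ j, ∏ l, strProd q (fun y => mob t⁻¹ (y / (q ^ k j * u j))) (k' l) (u' l)) *
    (∏ b ∈ univ.erase a, strProd q (mob t) (p + 1) (u i / v b)) *
    (∏ b ∈ univ.erase a, ∏ l, strProd q (fun y => mob t (y / v' b)) (k' l) (u' l)) * hlast

section

variable {q t : ℂ} {u v : ℂ → ι → ℂ} {β : ℂ} (hq : q ≠ 0) (ht : t ≠ 0) (hr : NonRoot q)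
  (hβ0 : β ≠ 0)
  (hu : ∀ i, DifferentiableAt ℂ (fun y => u y i) β)
  (hv : ∀ i, DifferentiableAt ℂ (fun y => v y i) β)
  (hu0 : ∀ i, u β i ≠ 0) (hv0 : ∀ i, v β i ≠ 0) {i a : ι} {p : ℕ}
  (huv : ∀ z, q ^ p * u z i / v z a = z / β)
  (huu : ∀ l b, l ≠ b → Off q (u β l) (u β b))
  (hoff : ∀ l b, (l ≠ i ∨ b ≠ a) → Off q (u β l) (v β b))

include hq ht hr hβ0 hu hv hu0 hv0 huv huu hoff in
lemma tendsto_mul_term_cross (k : ι → ℕ) :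
    Tendsto (fun z => (1 - z / β) * term q t (u z) (v z) k) (𝓝[≠] β)
      (𝓝 (if p < k i then term q t (u β) (v β) k else 0)) := by
  have hva : q ^ p * u β i = v β a := by
    rw [← div_eq_one_iff_eq (hv0 a), huv, div_self hβ0]
  have hcl : ∀ l m c, m < k l → q ^ m * u β l = node q (u β) (v β) k c →
      l = i ∧ m = p ∧ c = Sum.inr a := by
    intro l m c hm h
    rcases c with b | b
    · change q ^ m * u β l = q ^ k b * u β b at h
      by_cases hlb : l = b
      · subst hlb
        exact absurd h (hr.pow_mul_ne hq (hu0 l) hm.ne)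
      · exact absurd h ((huu l b hlb).pow_mul_ne hq _ _)
    · change q ^ m * u β l = v β b at h
      by_cases hlb : l ≠ i ∨ b ≠ a
      · exact absurd h ((hoff l b hlb).pow_mul hq m).ne
      · push Not at hlb
        obtain ⟨rfl, rfl⟩ := hlb
        refine ⟨rfl, ?_, rfl⟩
        by_contra hne
        exact hr.pow_mul_ne hq (hu0 l) hne (h.trans hva.symm)
  split_ifs with hp
  · have key := tendsto_mul_term (t := t) hu hv hq hu0 hv0 k (i := i) (m := p) (c := Sum.inr a)
      hp hva hcl (by
        simp only [node, Sum.elim_inr, huv]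
        filter_upwards [self_mem_nhdsWithin] with z hz h
        exact hz ((div_eq_one_iff_eq hβ0).1 h))
    simpa only [node, Sum.elim_inr, huv] using key
  · refine tendsto_mul_term_zero hu hv hq ht hu0 hv0 k ?_ fun l m c h1 h2 => ?_
    · have : Continuous fun z => 1 - z / β := by fun_prop
      simpa [hβ0] using (this.tendsto β).mono_left (nhdsWithin_le_nhds (s := {β}ᶜ))
    · obtain ⟨rfl, rfl, rfl⟩ := hcl l m c h1 h2
      exact hp h1

-- Only exponents with `k i > p` contribute to the residue; subtracting `p + 1` from `k i`
-- identifies them with all exponents of degree `K - (p + 1)`.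
include hq ht hr hβ0 hu hv hu0 hv0 huv huu hoff in
lemma tendsto_mul_termSum_cross (K : ℕ) :
    Tendsto (fun z => (1 - z / β) * termSum K q t (u z) (v z)) (𝓝[≠] β)
      (𝓝 (if p < K then shiftCoeff q t p (u β) (v β) i a *
        termSum (K - (p + 1)) q t (Function.update (u β) i (q ^ (p + 1) * u β i))
          (Function.update (v β) a ((q ^ (p + 1))⁻¹ * v β a)) else 0)) := by
  have hva : q ^ p * u β i = v β a := by
    rw [← div_eq_one_iff_eq (hv0 a), huv, div_self hβ0]
  have key := tendsto_finsetSum (piAntidiag (univ : Finset ι) K)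
    fun k (_ : k ∈ piAntidiag univ K) =>
      tendsto_mul_term_cross hq ht hr hβ0 hu hv hu0 hv0 huv huu hoff k
  simp only [← mul_sum] at key
  refine (key.congr fun _ => rfl).trans (le_of_eq (congrArg 𝓝 ?_))
  rw [← sum_filter]
  split_ifs with hpK
  · rw [termSum, mul_sum]
    symm
    have hle : ∀ k ∈ piAntidiag (univ : Finset ι) K, k i ≤ K := fun k hk => by
      rw [← (mem_piAntidiag.1 hk).1]; exact single_le_sum (by simp) (mem_univ i)
    have hsum : ∀ (k : ι → ℕ) (x : ℕ),
        univ.sum (Function.update k i x) = x + ∑ l ∈ univ.erase i, k l := fun k x => by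
      rw [sum_update_of_mem (mem_univ i), sdiff_singleton_eq_erase]
    have hsum' : ∀ k : ι → ℕ, univ.sum k = k i + ∑ l ∈ univ.erase i, k l := fun k =>
      (add_sum_erase univ k (mem_univ i)).symm
    refine sum_nbij' (fun k => Function.update k i (p + 1 + k i))
      (fun k => Function.update k i (k i - (p + 1))) ?_ ?_ ?_ ?_ ?_
    · intro k hk
      rw [mem_piAntidiag] at hk
      rw [mem_filter, mem_piAntidiag, Function.update_self, hsum]
      rw [hsum'] at hk
      exact ⟨⟨by omega, by simp⟩, by omega⟩
    · intro k hk
      rw [mem_filter, mem_piAntidiag] at hk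
      rw [mem_piAntidiag, hsum]
      rw [hsum'] at hk
      exact ⟨by omega, by simp⟩
    · intro k _
      simp
    · intro k hk
      have := (mem_filter.1 hk).2
      simp only [Function.update_self, Function.update_idem]
      rw [show p + 1 + (k i - (p + 1)) = k i by omega, Function.update_eq_self]
    · intro k _
      refine (term_shift hq ht hu0 hva.symm rfl rfl rfl fun l m hm h => ?_).symm
      rw [← hva] at h
      by_cases hl : l = i
      · subst hl
        rw [← mul_assoc, ← pow_add, Function.update_self] at h
        exact hr.pow_mul_ne hq (hu0 l) (by omega) h
      · exact (((huu l i hl).pow_mul hq _).pow_mul_ne hq _ _) h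
  · symm
    rw [sum_eq_zero]
    intro k hk
    rw [mem_filter] at hk
    have : k i ≤ K := by
      rw [← (mem_piAntidiag.1 hk.1).1]; exact single_le_sum (by simp) (mem_univ i)
    omega

end

end QSource

/-! ### The difference of the two sides is constant in each `u i`. -/

namespace QSource

open Finset Filter Topology

variable {ι : Type*}

/-- The conditions under which no denominator of degree `K` vanishes. -/
structure Adm (q : ℂ) (K : ℕ) (u v : ι → ℂ) : Prop where
  u_ne : ∀ i, u i ≠ 0
  v_ne : ∀ a, v a ≠ 0
  uu : ∀ i j, i ≠ j → ∀ p : ℕ, p < K → u i ≠ q ^ p * u j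
  vv : ∀ a b, a ≠ b → ∀ p : ℕ, p < K → v a ≠ q ^ p * v b
  vu : ∀ a j, ∀ p : ℕ, p < K → v a ≠ q ^ p * u j

/-- The source identity of degree `K`. -/
def Source [Fintype ι] [DecidableEq ι] (K : ℕ) (q t : ℂ) (u v : ι → ℂ) : Prop :=
  termSum K q t u v = termSum K q t v⁻¹ u⁻¹

lemma tame_congr {l : Filter ℂ} {f g : ℂ → ℂ} (hf : Tame l f) (h : ∀ᶠ z in l, f z = g z) :
    Tame l g := by
  have h' : f =ᶠ[l] g := h
  rcases hf with ⟨c, hc⟩ | hf | hf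
  · exact Or.inl ⟨c, by filter_upwards [hc, h] with z h1 h2; rw [← h2, h1]⟩
  · exact Or.inr (Or.inl (hf.congr' h'))
  · exact Or.inr (Or.inr (hf.congr' h'))

lemma tame_const (l : Filter ℂ) (c : ℂ) : Tame l fun _ => c :=
  Or.inl ⟨c, Eventually.of_forall fun _ => rfl⟩

/-- A filter along which `z` is nonzero and every monomial `c z`, `c z⁻¹` is tame. -/
def Polar (l : Filter ℂ) : Prop :=
  (∀ᶠ z in l, z ≠ 0) ∧ (∀ c : ℂ, Tame l fun z => c * z) ∧ ∀ c : ℂ, Tame l fun z => c * z⁻¹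

lemma tendsto_const_mul_cocompact {l : Filter ℂ} {f : ℂ → ℂ} {c : ℂ} (hc : c ≠ 0)
    (hf : Tendsto f l (cocompact ℂ)) : Tendsto (fun z => c * f z) l (cocompact ℂ) :=
  (Homeomorph.mulLeft₀ c hc).isClosedEmbedding.tendsto_cocompact.comp hf

lemma polar_of_tendsto_zero {l : Filter ℂ} (h0 : ∀ᶠ z in l, z ≠ 0) (h : Tendsto id l (𝓝 (0 : ℂ)))
    (h' : Tendsto (fun z : ℂ => z⁻¹) l (cocompact ℂ)) : Polar l := by
  refine ⟨h0, fun c => Or.inr (Or.inl (by simpa using h.const_mul c)), fun c => ?_⟩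
  by_cases hc : c = 0
  · simpa [hc] using tame_const l 0
  · exact Or.inr (Or.inr (tendsto_const_mul_cocompact hc h'))

lemma polar_zero : Polar (𝓝[≠] (0 : ℂ)) := by
  refine polar_of_tendsto_zero self_mem_nhdsWithin nhdsWithin_le_nhds ?_
  rw [← Metric.cobounded_eq_cocompact]
  exact tendsto_inv₀_nhdsNE_zero

lemma polar_cocompact : Polar (cocompact ℂ) := by
  refine ⟨isCompact_singleton.compl_mem_cocompact, fun c => ?_, fun c => ?_⟩
  · by_cases hc : c = 0
    · simpa [hc] using tame_const _ 0
    · exact Or.inr (Or.inr (tendsto_const_mul_cocompact hc tendsto_id))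
  · refine Or.inr (Or.inl ?_)
    have : Tendsto (fun z : ℂ => z⁻¹) (cocompact ℂ) (𝓝 0) := by
      rw [← Metric.cobounded_eq_cocompact]
      exact tendsto_inv₀_cobounded
    simpa using this.const_mul c

variable [Fintype ι] [DecidableEq ι] {K : ℕ} {q t : ℂ} {u v : ι → ℂ} {i : ι}

/-- The difference of the two sides of the source identity, as a function of `u i`. -/
noncomputable def defect (K : ℕ) (q t : ℂ) (u v : ι → ℂ) (i : ι) (z : ℂ) : ℂ :=
  termSum K q t (Function.update u i z) v - termSum K q t v⁻¹ (Function.update u i z)⁻¹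

/-- In terms of `u i = z`, every ratio entering a factor is constant or a constant multiple of `z`
or `z⁻¹`, hence tame at `0` and at infinity. -/
lemma exists_tendsto_defect (hq : q ≠ 0) {l : Filter ℂ} (hl : Polar l) :
    ∃ L, Tendsto (defect K q t u v i) l (𝓝 L) := by
  obtain ⟨h0, hl1, hl2⟩ := hl
  have h1 : ∀ k, ∃ L, Tendsto (fun z => term q t (Function.update u i z) v k) l (𝓝 L) := by
    intro k
    refine exists_tendsto_term q t (v := fun _ => v) k fun l' m c => ?_
    rcases c with b | a
    · simp only [node, Sum.elim_inl]
      by_cases h2 : l' = i <;> by_cases h3 : b = i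
      · subst h2; subst h3
        refine tame_congr (tame_const l (q ^ m / q ^ k b)) ?_
        filter_upwards [h0] with z hz
        have := pow_ne_zero (k b) hq
        simp only [Function.update_self]
        field_simp
      · subst h2
        simp only [Function.update_self, Function.update_of_ne h3]
        refine tame_congr (hl1 (q ^ m / (q ^ k b * u b))) (Eventually.of_forall fun z => ?_)
        ring
      · subst h3
        simp only [Function.update_self, Function.update_of_ne h2]
        refine tame_congr (hl2 (q ^ m * u l' / q ^ k b)) (Eventually.of_forall fun z => ?_)
        rw [div_mul_eq_div_div]; ring
      · simp only [Function.update_of_ne h2, Function.update_of_ne h3]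
        exact tame_const _ _
    · simp only [node, Sum.elim_inr]
      by_cases h2 : l' = i
      · subst h2
        simp only [Function.update_self]
        refine tame_congr (hl1 (q ^ m / v a)) (Eventually.of_forall fun z => ?_)
        ring
      · simp only [Function.update_of_ne h2]
        exact tame_const _ _
  have h2 : ∀ k, ∃ L, Tendsto (fun z => term q t v⁻¹ (Function.update u i z)⁻¹ k) l (𝓝 L) := by
    intro k
    refine exists_tendsto_term q t (u := fun _ => v⁻¹)
      (v := fun z => (Function.update u i z)⁻¹) k fun l' m c => ?_
    rcases c with b | a
    · simp only [node, Sum.elim_inl]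
      exact tame_const _ _
    · simp only [node, Sum.elim_inr, Pi.inv_apply]
      by_cases h2 : a = i
      · subst h2
        simp only [Function.update_self]
        refine tame_congr (hl1 (q ^ m * (v l')⁻¹)) (Eventually.of_forall fun z => ?_)
        simp
      · simp only [Function.update_of_ne h2]
        exact tame_const _ _
  choose L1 hL1 using h1
  choose L2 hL2 using h2
  exact ⟨_, (tendsto_finsetSum _ fun k _ => hL1 k).sub (tendsto_finsetSum _ fun k _ => hL2 k)⟩

lemma le_of_mem_piAntidiag {k : ι → ℕ} (hk : k ∈ piAntidiag (univ : Finset ι) K) (l : ι) :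
    k l ≤ K := by
  rw [← (mem_piAntidiag.1 hk).1]; exact single_le_sum (by simp) (mem_univ l)

section

variable (hq : q ≠ 0) (ht : t ≠ 0) (hr : NonRoot q) (hu0 : ∀ l, u l ≠ 0) (hv0 : ∀ a, v a ≠ 0)
  (huu : ∀ l b, l ≠ b → l ≠ i → b ≠ i → Off q (u l) (u b))
  (hvv : ∀ a b, a ≠ b → Off q (v a) (v b))
  (huv : ∀ l a, l ≠ i → Off q (u l) (v a))

omit [Fintype ι] in
include hu0 in
lemma update_ne_zero {z : ℂ} (hz : z ≠ 0) (l : ι) : Function.update u i z l ≠ 0 := by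
  by_cases h : l = i
  · subst h; simpa using hz
  · simpa [Function.update_of_ne h] using hu0 l

-- In the dual sum the ends of strings involve only `v`, so `z` meets no other `u j`; the only
-- possible poles are at `q ^ p * z = v a`.
include hq ht hr hu0 hv0 hvv huv in
lemma differentiableAt_termSum_star {z : ℂ} (hz : z ≠ 0)
    (hzv : ∀ a, ∀ p < K, q ^ p * z ≠ v a) :
    DifferentiableAt ℂ (fun z => termSum K q t v⁻¹ (Function.update u i z)⁻¹) z := by
  unfold termSum
  refine DifferentiableAt.fun_sum fun k hk => ?_
  refine differentiableAt_term (u := fun _ => v⁻¹) (v := fun z => (Function.update u i z)⁻¹)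
    (differentiableAt_const q) (differentiableAt_const t) (fun l => differentiableAt_const _)
    (fun l => (differentiable_update i l).differentiableAt.inv (update_ne_zero hu0 hz l)) hq ht
    (fun l => inv_ne_zero (hv0 l)) (fun l => inv_ne_zero (update_ne_zero hu0 hz l)) k
    fun l m c hm h => ?_
  rcases c with b | b
  · change q ^ m * (v l)⁻¹ = q ^ k b * (v b)⁻¹ at h
    by_cases hlb : l = b
    · subst hlb
      exact hr.pow_mul_ne hq (inv_ne_zero (hv0 l)) hm.ne h
    · exact (hvv l b hlb).inv.pow_mul_ne hq _ _ h
  · change q ^ m * (v l)⁻¹ = (Function.update u i z b)⁻¹ at h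
    by_cases hb : b = i
    · subst hb
      rw [Function.update_self] at h
      refine hzv l m (hm.trans_le (le_of_mem_piAntidiag hk l)) ?_
      have := hv0 l
      field_simp at h
      exact h
    · rw [Function.update_of_ne hb] at h
      exact (((huv b l hb).symm hq).inv.pow_mul hq m).ne h

include hq ht hr hu0 hv0 huu huv in
lemma differentiableAt_termSum_update {z : ℂ} (hz : z ≠ 0)
    (hzv : ∀ a, ∀ p < K, q ^ p * z ≠ v a)
    (hzu : ∀ j ≠ i, ∀ m ≤ K, ∀ n ≤ K, q ^ m * z ≠ q ^ n * u j) :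
    DifferentiableAt ℂ (fun z => termSum K q t (Function.update u i z) v) z := by
  unfold termSum
  refine DifferentiableAt.fun_sum fun k hk => ?_
  refine differentiableAt_term (u := fun z => Function.update u i z) (v := fun _ => v)
    (differentiableAt_const q) (differentiableAt_const t)
    (fun l => (differentiable_update i l).differentiableAt)
    (fun l => differentiableAt_const _) hq ht
    (fun l => update_ne_zero hu0 hz l) hv0 k fun l m c hm h => ?_
  have hkl := le_of_mem_piAntidiag hk l
  rcases c with b | b
  · have hkb := le_of_mem_piAntidiag hk b
    change q ^ m * Function.update u i z l = q ^ k b * Function.update u i z b at h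
    by_cases hlb : l = b
    · subst hlb
      exact hr.pow_mul_ne hq (update_ne_zero hu0 hz l) hm.ne h
    by_cases hl : l = i
    · subst hl
      rw [Function.update_self, Function.update_of_ne (Ne.symm hlb)] at h
      exact hzu b (Ne.symm hlb) m (by omega) (k b) hkb h
    by_cases hb : b = i
    · subst hb
      rw [Function.update_self, Function.update_of_ne hlb] at h
      exact hzu l hlb (k b) hkb m (by omega) h.symm
    rw [Function.update_of_ne hl, Function.update_of_ne hb] at h
    exact (huu l b hlb hl hb).pow_mul_ne hq _ _ h
  · change q ^ m * Function.update u i z l = v b at h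
    by_cases hl : l = i
    · subst hl
      rw [Function.update_self] at h
      exact hzv b m (by omega) h
    · rw [Function.update_of_ne hl] at h
      exact ((huv l b hl).pow_mul hq m).ne h

lemma tendsto_sub_mul_of_div {F : ℂ → ℂ} {β : ℂ} (hβ : β ≠ 0)
    (h : Tendsto (fun z => (1 - z / β) * F z) (𝓝[≠] β) (𝓝 0)) :
    Tendsto (fun z => (z - β) * F z) (𝓝[≠] β) (𝓝 0) := by
  have h1 := h.const_mul (-β)
  rw [mul_zero] at h1
  refine h1.congr fun z => ?_
  field_simp
  ring

include hq ht hr hu0 hv0 huu hvv huv in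
lemma tendsto_mul_defect_string {j : ι} (hij : i ≠ j) (d : ℤ) :
    Tendsto (fun z => (1 - z / (q ^ d * u j)) * defect K q t u v i z) (𝓝[≠] (q ^ d * u j))
      (𝓝 0) := by
  have hβ0 : q ^ d * u j ≠ 0 := mul_ne_zero (zpow_ne_zero _ hq) (hu0 j)
  have h1 := tendsto_mul_termSum_string hq ht hr hu0 hv0 hij huu huv d K
  have h2 := (differentiableAt_termSum_star (K := K) hq ht hr hu0 hv0 hvv huv hβ0 (fun a p _ =>
    (((huv j a hij.symm).zpow_mul hq d).pow_mul hq p).ne)).continuousAt.tendsto.mono_left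
      (nhdsWithin_le_nhds (s := {q ^ d * u j}ᶜ))
  have h3 : Tendsto (fun z => 1 - z / (q ^ d * u j)) (𝓝[≠] (q ^ d * u j)) (𝓝 0) := by
    have : Continuous fun z => 1 - z / (q ^ d * u j) := by fun_prop
    have h4 := (this.tendsto (q ^ d * u j)).mono_left
      (nhdsWithin_le_nhds (s := {q ^ d * u j}ᶜ))
    rwa [div_self hβ0, sub_self] at h4
  have h4 := h1.sub (h3.mul h2)
  rw [zero_mul, sub_zero] at h4
  refine h4.congr fun z => ?_
  rw [defect, mul_sub]

include hq ht hr hu0 hv0 huu hvv huv in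
lemma tendsto_mul_defect_cross
    (ih : ∀ K' < K, ∀ u v : ι → ℂ, Adm q K' u v → Source K' q t u v) (a : ι) {p : ℕ} (hp : p < K) :
    Tendsto (fun z => (1 - z / ((q ^ p)⁻¹ * v a)) * defect K q t u v i z)
      (𝓝[≠] ((q ^ p)⁻¹ * v a)) (𝓝 0) := by
  have hqp := pow_ne_zero p hq
  set β := (q ^ p)⁻¹ * v a with hβ
  have hβ0 : β ≠ 0 := mul_ne_zero (inv_ne_zero hqp) (hv0 a)
  have hβv : q ^ p * β = v a := by rw [hβ]; field_simp
  have hβz : β = q ^ (-p : ℤ) * v a := by rw [hβ, zpow_neg, zpow_natCast]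
  set U := Function.update u i β with hU
  have hU0 : ∀ l, U l ≠ 0 := update_ne_zero hu0 hβ0
  have hUi : U i = β := Function.update_self ..
  have hUu : ∀ l, l ≠ i → U l = u l := fun l hl => Function.update_of_ne hl ..
  have hUU : ∀ l b, l ≠ b → Off q (U l) (U b) := by
    intro l b hlb
    by_cases hl : l = i
    · subst hl
      rw [hUi, hUu b (Ne.symm hlb), hβz]
      exact ((huv b a (Ne.symm hlb)).symm hq).zpow_mul hq _
    by_cases hb : b = i
    · subst hb
      rw [hUi, hUu l hl, hβz]
      exact (((huv l a hl).symm hq).zpow_mul hq _).symm hq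
    rw [hUu l hl, hUu b hb]
    exact huu l b hlb hl hb
  have hUV : ∀ l b, (l ≠ i ∨ b ≠ a) → Off q (U l) (v b) := by
    intro l b hlb
    by_cases hl : l = i
    · subst hl
      rw [hUi, hβz]
      exact (hvv a b (by tauto)).zpow_mul hq _
    · rw [hUu l hl]; exact huv l b hl
  have h1 := tendsto_mul_termSum_cross (t := t) (u := fun z => Function.update u i z)
    (v := fun _ => v) (β := β) (i := i) (a := a) (p := p) hq ht hr hβ0
    (fun l => (differentiable_update i l).differentiableAt) (fun l => differentiableAt_const _)
    hU0 hv0 (fun z => by simp only [Function.update_self]; rw [hβ]; field_simp) hUU hUV K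
  have h2 := tendsto_mul_termSum_cross (t := t) (u := fun _ => v⁻¹)
    (v := fun z => (Function.update u i z)⁻¹) (β := β) (i := a) (a := i) (p := p) hq ht hr hβ0
    (fun l => differentiableAt_const _)
    (fun l => (differentiable_update i l).differentiableAt.inv (hU0 l))
    (fun l => inv_ne_zero (hv0 l)) (fun l => inv_ne_zero (hU0 l))
    (fun z => by simp only [Function.update_self, Pi.inv_apply]; rw [hβ]; field_simp)
    (fun l b h => (hvv l b h).inv)
    (fun l b h => ((hUV b l h.symm).symm hq).inv) K
  rw [if_pos hp] at h1 h2
  -- At `β` the shifted variables are `q * v a` and `q^{-(p+1)} * v a`. Their exponents of `q` are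
  -- positive and negative respectively, so the shifted point is still admissible and the induction
  -- hypothesis applies.
  have hs : Source (K - (p + 1)) q t (Function.update U i (q ^ (p + 1) * U i))
      (Function.update v a ((q ^ (p + 1))⁻¹ * v a)) := by
    have hUi' : q ^ (p + 1) * U i = q ^ (1 : ℤ) * v a := by
      rw [hUi, ← hβv, zpow_one]; ring
    have hz : (q ^ (p + 1))⁻¹ = q ^ (-(p + 1 : ℕ) : ℤ) := by rw [zpow_neg, zpow_natCast]
    rw [hUi', hz]
    have hoff : ∀ {x y : ℂ} {n : ℕ}, Off q x y → x ≠ q ^ n * y := fun h => by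
      simpa using h.pow_mul_ne hq 0 _
    refine ih _ (by omega) _ _ ⟨?_, ?_, ?_, ?_, ?_⟩
    · exact update_ne_zero hU0 (mul_ne_zero (zpow_ne_zero _ hq) (hv0 a))
    · exact update_ne_zero hv0 (mul_ne_zero (zpow_ne_zero _ hq) (hv0 a))
    · intro l b hlb n _
      by_cases hl : l = i
      · subst hl
        rw [Function.update_self, Function.update_of_ne (Ne.symm hlb), hUu b (Ne.symm hlb)]
        exact hoff (((huv b a (Ne.symm hlb)).symm hq).zpow_mul hq _)
      by_cases hb : b = i
      · subst hb
        rw [Function.update_self, Function.update_of_ne hl, hUu l hl]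
        exact hoff ((((huv l a hl).symm hq).zpow_mul hq _).symm hq)
      rw [Function.update_of_ne hl, Function.update_of_ne hb]
      exact hoff (hUU l b hlb)
    · intro l b hlb n _
      by_cases hl : l = a
      · subst hl
        rw [Function.update_self, Function.update_of_ne (Ne.symm hlb)]
        exact hoff ((hvv l b hlb).zpow_mul hq _)
      by_cases hb : b = a
      · subst hb
        rw [Function.update_self, Function.update_of_ne hl]
        exact hoff (((hvv b l (Ne.symm hlb)).zpow_mul hq _).symm hq)
      rw [Function.update_of_ne hl, Function.update_of_ne hb]
      exact hoff (hvv l b hlb)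
    · intro b l n _
      by_cases hl : l = i <;> by_cases hb : b = a
      · subst hl; subst hb
        rw [Function.update_self, Function.update_self, ← mul_assoc, ← zpow_natCast q n,
          ← zpow_add₀ hq]
        exact hr.zpow_mul_ne hq (hv0 b) (by omega)
      · subst hl
        rw [Function.update_self, Function.update_of_ne hb]
        exact hoff (((hvv a b (Ne.symm hb)).zpow_mul hq _).symm hq)
      · subst hb
        rw [Function.update_self, Function.update_of_ne hl, hUu l hl]
        exact hoff (((huv l b hl).symm hq).zpow_mul hq _)
      · rw [Function.update_of_ne hl, Function.update_of_ne hb]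
        exact hoff ((hUV l b (Or.inl hl)).symm hq)
  have hinv : ∀ (w : ι → ℂ) (b : ι) (c : ℂ), (Function.update w b c)⁻¹ =
      Function.update w⁻¹ b c⁻¹ := by
    intro w b c
    funext l
    by_cases h : l = b
    · subst h; simp
    · simp [Function.update_of_ne h]
  rw [Source, hinv, hinv, mul_inv, mul_inv, inv_inv] at hs
  rw [← hU] at h1 h2
  -- The lower-degree identity makes the two residues literally equal.
  rw [shiftCoeff_inv, Pi.inv_apply, Pi.inv_apply, ← hs] at h2
  have h3 := h1.sub h2
  rw [sub_self] at h3
  refine h3.congr fun z => ?_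
  rw [defect, mul_sub]

include hq ht hr hu0 hv0 huu hvv huv in
lemma defect_eq (ih : ∀ K' < K, ∀ u v : ι → ℂ, Adm q K' u v → Source K' q t u v) {z w : ℂ}
    (hz0 : z ≠ 0) (hzu : ∀ l ≠ i, Off q z (u l)) (hzv : ∀ a, Off q z (v a))
    (hw0 : w ≠ 0) (hwu : ∀ l ≠ i, Off q w (u l)) (hwv : ∀ a, Off q w (v a)) :
    defect K q t u v i z = defect K q t u v i w := by
  -- All exponents are at most `K`, so finitely many candidate poles suffice: the origin, the points
  -- `q ^ d * u l` with `|d| ≤ K`, and the points `q^{-p} v a` with `p < K`.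
  set B : Set ℂ := {0} ∪ ((fun x : ι × ℤ => q ^ x.2 * u x.1) '' ({i}ᶜ ×ˢ Set.Icc (-K : ℤ) K) ∪
    (fun x : ι × ℕ => (q ^ x.2)⁻¹ * v x.1) '' (Set.univ ×ˢ Set.Iio K)) with hB
  have hBfin : B.Finite := (Set.finite_singleton 0).union
    (((Set.toFinite _).image _).union ((Set.toFinite _).image _))
  obtain ⟨L, hL⟩ := exists_tendsto_defect (K := K) (t := t) (u := u) (v := v) (i := i) hq
    polar_cocompact
  have hmem : ∀ x : ℂ, x ≠ 0 → (∀ l ≠ i, Off q x (u l)) → (∀ a, Off q x (v a)) → x ∉ B := by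
    rintro x h1 h2 h3 (h | ⟨⟨l, d⟩, ⟨hl, -⟩, rfl⟩ | ⟨⟨a, p⟩, -, rfl⟩)
    · exact h1 h
    · exact h2 l hl d rfl
    · exact h3 a (-p) (by simp)
  have key : ∀ x ∉ B, defect K q t u v i x = L := by
    intro x hx
    refine eq_of_removable hBfin ?_ ?_ hL hx
    · intro y hy
      simp only [hB, Set.mem_union, Set.mem_singleton_iff, not_or] at hy
      have hyv : ∀ a, ∀ p < K, q ^ p * y ≠ v a := by
        intro a p hp h
        refine hy.2.2 ⟨(a, p), ⟨Set.mem_univ _, hp⟩, ?_⟩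
        have := pow_ne_zero p hq
        simp only [← h]
        field_simp
      refine (differentiableAt_termSum_update hq ht hr hu0 hv0 huu huv hy.1 hyv ?_).sub
        (differentiableAt_termSum_star hq ht hr hu0 hv0 hvv huv hy.1 hyv)
      intro j hj m hm n hn h
      refine hy.2.1 ⟨(j, (n : ℤ) - m), ⟨hj, ?_⟩, ?_⟩
      · simp only [Set.mem_Icc]; omega
      · have := pow_ne_zero m hq
        simp only
        rw [zpow_sub₀ hq, zpow_natCast, zpow_natCast, div_mul_eq_mul_div, ← h]
        field_simp
    · rintro b (h | ⟨⟨l, d⟩, ⟨hl, -⟩, rfl⟩ | ⟨⟨a, p⟩, ⟨-, hp⟩, rfl⟩)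
      · rw [Set.mem_singleton_iff] at h
        subst h
        obtain ⟨L', hL'⟩ := exists_tendsto_defect (K := K) (t := t) (u := u) (v := v) (i := i) hq
          polar_zero
        have h1 : Tendsto (fun z : ℂ => z - 0) (𝓝[≠] 0) (𝓝 0) := by
          simp only [sub_zero]
          exact tendsto_id.mono_left nhdsWithin_le_nhds
        simpa using h1.mul hL'
      · exact tendsto_sub_mul_of_div (mul_ne_zero (zpow_ne_zero _ hq) (hu0 l))
          (tendsto_mul_defect_string hq ht hr hu0 hv0 huu hvv huv (Ne.symm hl) d)
      · exact tendsto_sub_mul_of_div (mul_ne_zero (inv_ne_zero (pow_ne_zero _ hq)) (hv0 a))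
          (tendsto_mul_defect_cross hq ht hr hu0 hv0 huu hvv huv ih a hp)
  rw [key z (hmem z hz0 hzu hzv), key w (hmem w hw0 hwu hwv)]

end

end QSource

/-! ### Vanishing of the difference and removal of the genericity assumptions. -/

namespace QSource

open Finset Filter Topology

lemma Off.mul_left {q a b c : ℂ} (hc : c ≠ 0) (h : Off q a b) : Off q (c * a) (c * b) := by
  intro m hm
  apply h m
  rw [mul_left_comm] at hm
  exact mul_left_cancel₀ hc hm

section Adm

variable {ι : Type*} {q : ℂ} {K : ℕ} {u v : ι → ℂ}

lemma Adm.star (h : Adm q K u v) : Adm q K v⁻¹ u⁻¹ := by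
  have key : ∀ {x y : ℂ} {p : ℕ}, x ≠ 0 → y ≠ 0 → y ≠ q ^ p * x → x⁻¹ ≠ q ^ p * y⁻¹ := by
    intro x y p hx hy hne h
    apply hne
    field_simp at h
    rw [h, mul_comm]
  exact ⟨fun i => inv_ne_zero (h.v_ne i), fun i => inv_ne_zero (h.u_ne i),
    fun i j hij p hp => key (h.v_ne i) (h.v_ne j) (h.vv j i hij.symm p hp),
    fun i j hij p hp => key (h.u_ne i) (h.u_ne j) (h.uu j i hij.symm p hp),
    fun a j p hp => key (h.u_ne a) (h.v_ne j) (h.vu j a p hp)⟩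

lemma Adm.mul_ne_node [Fintype ι] [DecidableEq ι] (h : Adm q K u v) (hq : q ≠ 0)
    (hqq : ∀ p : ℕ, 1 ≤ p → p ≤ K → q ^ p ≠ 1) {k : ι → ℕ}
    (hk : k ∈ piAntidiag (univ : Finset ι) K) {l : ι} {m : ℕ} {c : ι ⊕ ι} (hm : m < k l) :
    q ^ m * u l ≠ node q u v k c := by
  have hpow : ∀ {a b : ℕ} {x y : ℂ}, a ≤ b → q ^ a * x = q ^ b * y → x = q ^ (b - a) * y := by
    intro a b x y hab h
    have := pow_ne_zero a hq
    apply mul_left_cancel₀ this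
    rw [h, ← mul_assoc, ← pow_add, Nat.add_sub_cancel' hab]
  have hkl := le_of_mem_piAntidiag hk l
  intro he
  rcases c with b | a
  · change q ^ m * u l = q ^ k b * u b at he
    by_cases hlb : l = b
    · subst hlb
      have h1 := hpow hm.le he
      apply hqq (k l - m) (by omega) (by omega)
      exact mul_right_cancel₀ (h.u_ne l) (by rw [one_mul]; exact h1.symm)
    -- The range `p < K` in `Adm` suffices because `k l ≥ 1`: the gap `k b - m` is at most `K - k l
    -- < K`.
    · have hsum : k l + k b ≤ K := by
        rw [← (mem_piAntidiag.1 hk).1, ← add_sum_erase univ k (mem_univ l)]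
        gcongr
        exact single_le_sum (f := k) (by simp) (mem_erase.2 ⟨Ne.symm hlb, mem_univ b⟩)
      rcases le_total m (k b) with h1 | h1
      · exact h.uu l b hlb _ (by omega) (hpow h1 he)
      · exact h.uu b l (Ne.symm hlb) _ (by omega) (hpow h1 he.symm)
  · exact h.vu a l m (by omega) he.symm

lemma differentiableAt_termSum [Fintype ι] [DecidableEq ι] {q t : ℂ → ℂ} {u v : ℂ → ι → ℂ} {z : ℂ}
    (hq : DifferentiableAt ℂ q z) (ht : DifferentiableAt ℂ t z)
    (hu : ∀ i, DifferentiableAt ℂ (fun y => u y i) z)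
    (hv : ∀ i, DifferentiableAt ℂ (fun y => v y i) z) (hq0 : q z ≠ 0) (ht0 : t z ≠ 0)
    (hqq : ∀ p : ℕ, 1 ≤ p → p ≤ K → q z ^ p ≠ 1) (h : Adm (q z) K (u z) (v z)) :
    DifferentiableAt ℂ (fun y => termSum K (q y) (t y) (u y) (v y)) z :=
  DifferentiableAt.fun_sum fun k hk => differentiableAt_term hq ht hu hv hq0 ht0 h.u_ne h.v_ne k
    fun _ _ _ hm => h.mul_ne_node hq0 hqq hk hm

/-- The source identity at a point follows from the source identity off a countable subset of a
curve through that point. -/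
lemma source_of_curve [Fintype ι] [DecidableEq ι] {q t : ℂ → ℂ} {u v : ℂ → ι → ℂ} {z : ℂ}
    (hq : DifferentiableAt ℂ q z) (ht : DifferentiableAt ℂ t z)
    (hu : ∀ i, DifferentiableAt ℂ (fun y => u y i) z)
    (hv : ∀ i, DifferentiableAt ℂ (fun y => v y i) z) (hq0 : q z ≠ 0) (ht0 : t z ≠ 0)
    (hqq : ∀ p : ℕ, 1 ≤ p → p ≤ K → q z ^ p ≠ 1) (h : Adm (q z) K (u z) (v z))
    {S : Set ℂ} (hS : S.Countable)
    (hsrc : ∀ᶠ y in 𝓝 z, y ∉ S → Source K (q y) (t y) (u y) (v y)) :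
    Source K (q z) (t z) (u z) (v z) :=
  eq_of_eventually_notMem_countable
    (f := fun y => termSum K (q y) (t y) (u y) (v y))
    (g := fun y => termSum K (q y) (t y) (v y)⁻¹ (u y)⁻¹)
    (differentiableAt_termSum hq ht hu hv hq0 ht0 hqq h).continuousAt
    (differentiableAt_termSum (u := fun y => (v y)⁻¹) (v := fun y => (u y)⁻¹) hq ht
      (fun i => (hv i).inv (h.v_ne i)) (fun i => (hu i).inv (h.u_ne i)) hq0 ht0 hqq
      h.star).continuousAt hS hsrc

end Adm

variable {ι : Type*} [Fintype ι] [DecidableEq ι] {K : ℕ} {q t : ℂ}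

/-- In positive degree some string `i` is nonempty, and its first point contributes `mob t (u i / v
i) = mob t t⁻¹ = 0`. -/
lemma termSum_eq_zero {u v : ι → ℂ} (hK : K ≠ 0) (ht : t ≠ 0) (hu : ∀ l, u l / v l = t⁻¹) :
    termSum K q t u v = 0 := by
  refine sum_eq_zero fun k hk => ?_
  obtain ⟨i, hi⟩ : ∃ i, k i ≠ 0 := by
    by_contra! h
    exact hK (by rw [← (mem_piAntidiag.1 hk).1]; exact sum_eq_zero fun i _ => h i)
  refine prod_eq_zero (mem_univ i) (prod_eq_zero (mem_range.2 (Nat.pos_of_ne_zero hi)) ?_)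
  refine mul_eq_zero_of_right _ (prod_eq_zero (mem_univ i) ?_)
  rw [pow_zero, one_mul, hu, mob, mul_inv_cancel₀ ht]
  simp

lemma source_of_generic (hq : q ≠ 0) (ht : t ≠ 0) (hr : NonRoot q) (hK : K ≠ 0)
    (ih : ∀ K' < K, ∀ u v : ι → ℂ, Adm q K' u v → Source K' q t u v) {u v : ι → ℂ}
    (hu0 : ∀ l, u l ≠ 0) (hv0 : ∀ a, v a ≠ 0) (huu : ∀ l b, l ≠ b → Off q (u l) (u b))
    (hvv : ∀ a b, a ≠ b → Off q (v a) (v b)) (huv : ∀ l a, Off q (u l) (v a))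
    (htu : ∀ l a, Off q (t * u l) (v a)) (htv : ∀ a b, Off q (t * v a) (v b)) :
    Source K q t u v := by
  -- The variables indexed by `S` have already been moved to `t⁻¹ * v l`. The conditions on `t * u`
  -- and `t * v` keep every intermediate configuration generic.
  set U : Finset ι → ι → ℂ := fun S l => if l ∈ S then t⁻¹ * v l else u l with hU
  have hti := inv_ne_zero ht
  have hsc : ∀ {x y : ℂ}, Off q (t * x) y → Off q x (t⁻¹ * y) := fun {x y} h => by
    have := h.mul_left hti
    rwa [inv_mul_cancel_left₀ ht] at this
  have hU0 : ∀ S l, U S l ≠ 0 := by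
    intro S l
    simp only [hU]; split_ifs
    · exact mul_ne_zero hti (hv0 l)
    · exact hu0 l
  have hUU : ∀ S l b, l ≠ b → Off q (U S l) (U S b) := by
    intro S l b h
    simp only [hU]; split_ifs
    · exact (hvv l b h).mul_left hti
    · exact (hsc (htu b l)).symm hq
    · exact hsc (htu l b)
    · exact huu l b h
  have hUv : ∀ S l a, Off q (U S l) (v a) := by
    intro S l a
    simp only [hU]; split_ifs
    · exact (hsc (htv a l)).symm hq
    · exact huv l a
  have hconst : ∀ S : Finset ι, termSum K q t (U S) v - termSum K q t v⁻¹ (U S)⁻¹ =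
      termSum K q t u v - termSum K q t v⁻¹ u⁻¹ := by
    intro S
    induction S using Finset.induction_on with
    | empty => simp [hU]
    | insert i S hi hS =>
      rw [← hS]
      have hins : U (insert i S) = Function.update (U S) i (t⁻¹ * v i) := by
        funext l
        by_cases h : l = i
        · subst h; simp [hU]
        · simp [hU, h]
      have key := defect_eq (u := U S) (i := i) hq ht hr (hU0 S) hv0
        (fun l b h _ _ => hUU S l b h) hvv (fun l a _ => hUv S l a) ih
        (mul_ne_zero hti (hv0 i))
        (fun l hl => by
          have := hUU (insert i S) i l (Ne.symm hl)
          rwa [hins, Function.update_self, Function.update_of_ne hl] at this)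
        (fun a => (hsc (htv a i)).symm hq)
        (hU0 S i) (fun l hl => hUU S i l (Ne.symm hl)) (fun a => hUv S i a)
      simpa only [defect, ← hins, Function.update_eq_self] using key
  have huniv : U univ = fun l => t⁻¹ * v l := by simp [hU]
  have h0 := hconst univ
  rw [huniv, termSum_eq_zero hK ht fun l => mul_div_cancel_right₀ _ (hv0 l),
    termSum_eq_zero hK ht fun l => ?_, sub_self] at h0
  · exact (sub_eq_zero.1 h0.symm)
  · have := hv0 l
    simp only [Pi.inv_apply]
    field_simp

/-- Two solutions would force the linear equation to hold identically, giving `A = B` and then `c =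
d`. -/
lemma subsingleton_linear_eq {A B c d : ℂ} (hA : A ≠ 0) (hcd : c ≠ d) :
    {ε : ℂ | A * (1 + c * ε) = B * (1 + d * ε)}.Subsingleton := by
  intro x hx y hy
  simp only [Set.mem_ofPred_eq] at hx hy
  by_contra hne
  have h1 : (A * c - B * d) * (x - y) = 0 := by linear_combination hx - hy
  have h2 : A * c - B * d = 0 := (mul_eq_zero.1 h1).resolve_right (sub_ne_zero.2 hne)
  have h3 : A = B := by linear_combination hx - x * h2
  subst h3
  exact hcd (mul_left_cancel₀ hA (sub_eq_zero.1 h2))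

lemma source_of_nonRoot_of_off (hq : q ≠ 0) (ht : t ≠ 0) (hr : NonRoot q) (htq : Off q t 1)
    (u v : ι → ℂ) (h : Adm q K u v) : Source K q t u v := by
  induction K using Nat.strong_induction_on generalizing u v with
  | _ K ih =>
  by_cases hK : K = 0
  · subst hK; simp [Source, termSum, term]
  -- Distinct slopes: along the curve `w x * (1 + e x * ε)`, each forbidden coincidence between two
  -- different variables occurs for at most one `ε`.
  set e : ι ⊕ ι → ℂ := fun x => ((Fintype.equivFin (ι ⊕ ι) x : ℕ) : ℂ) with he
  have heinj : ∀ x y, x ≠ y → e x ≠ e y := by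
    intro x y hxy h
    apply hxy
    apply (Fintype.equivFin (ι ⊕ ι)).injective
    exact Fin.ext (Nat.cast_injective (R := ℂ) h)
  set w : ι ⊕ ι → ℂ := Sum.elim u v with hw
  have hw0 : ∀ x, w x ≠ 0 := by
    rintro (l | a)
    · exact h.u_ne l
    · exact h.v_ne a
  set S : Set ℂ := ⋃ (x : ι ⊕ ι) (y : ι ⊕ ι) (_ : x ≠ y) (m : ℤ),
    {ε | w x * (1 + e x * ε) = q ^ m * w y * (1 + e y * ε)} ∪
      {ε | t * w x * (1 + e x * ε) = q ^ m * w y * (1 + e y * ε)} with hS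
  have hSc : S.Countable := by
    refine Set.countable_iUnion fun x => Set.countable_iUnion fun y =>
      Set.countable_iUnion fun hxy => Set.countable_iUnion fun m => ?_
    exact (subsingleton_linear_eq (hw0 x) (heinj x y hxy)).countable.union
      (subsingleton_linear_eq (mul_ne_zero ht (hw0 x)) (heinj x y hxy)).countable
  have hu' : (fun i => w (Sum.inl i) * (1 + e (Sum.inl i) * 0)) = u := by
    funext i; simp [hw]
  have hv' : (fun i => w (Sum.inr i) * (1 + e (Sum.inr i) * 0)) = v := by
    funext i; simp [hw]
  have key := source_of_curve (K := K) (q := fun _ => q) (t := fun _ => t)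
    (u := fun ε i => w (Sum.inl i) * (1 + e (Sum.inl i) * ε))
    (v := fun ε i => w (Sum.inr i) * (1 + e (Sum.inr i) * ε)) (z := 0)
    (differentiableAt_const _) (differentiableAt_const _) (fun i => by fun_prop)
    (fun i => by fun_prop) hq ht (fun p hp _ => hr p hp) (by simpa only [hu', hv'] using h) hSc ?_
  · simpa only [hu', hv'] using key
  have hne : ∀ᶠ ε in 𝓝 (0 : ℂ), ∀ x, 1 + e x * ε ≠ 0 := by
    refine eventually_all.2 fun x => ?_
    have : ContinuousAt (fun ε => 1 + e x * ε) 0 := by fun_prop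
    exact this.eventually_ne (by simp)
  filter_upwards [hne] with ε hε hεS
  have hW0 : ∀ x, w x * (1 + e x * ε) ≠ 0 := fun x => mul_ne_zero (hw0 x) (hε x)
  simp only [hS, Set.mem_iUnion, not_exists, Set.mem_union, Set.mem_ofPred_eq, not_or] at hεS
  have hWW : ∀ x y, x ≠ y → Off q (w x * (1 + e x * ε)) (w y * (1 + e y * ε)) := by
    intro x y hxy m hm
    exact (hεS x y hxy m).1 (by rw [hm, mul_assoc])
  have htW : ∀ x y, x ≠ y → Off q (t * (w x * (1 + e x * ε))) (w y * (1 + e y * ε)) := by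
    intro x y hxy m hm
    exact (hεS x y hxy m).2 (by rw [mul_assoc t, hm, mul_assoc])
  refine source_of_generic hq ht hr hK (fun K' hK' u v h' => ih K' hK' u v h')
    (fun l => hW0 _) (fun a => hW0 _) (fun l b hlb => hWW _ _ (by simpa using hlb))
    (fun l b hlb => hWW _ _ (by simpa using hlb)) (fun l a => hWW _ _ (by simp))
    (fun l a => htW _ _ (by simp)) fun a b => ?_
  -- For `a = b` the ratio is `t` for every `ε`, so perturbing cannot help; here the hypothesis on
  -- `t` is needed.
  by_cases hab : a = b
  · subst hab
    have := htq.mul_left (hW0 (Sum.inr a))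
    rwa [mul_one, mul_comm] at this
  · exact htW _ _ (by simpa using hab)

/-- Varying `t` alone suffices, since admissibility does not involve `t` and the integer powers of
`q` form a countable set. -/
lemma source_of_nonRoot (hq : q ≠ 0) (ht : t ≠ 0) (hr : NonRoot q) (u v : ι → ℂ)
    (h : Adm q K u v) : Source K q t u v := by
  refine source_of_curve (q := fun _ => q) (t := fun z => z) (u := fun _ => u) (v := fun _ => v)
    (differentiableAt_const _) differentiableAt_fun_id (fun i => differentiableAt_const _)
    (fun i => differentiableAt_const _) hq ht (fun p hp _ => hr p hp) h
    (Set.countable_range fun m : ℤ => q ^ m) ?_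
  filter_upwards [continuousAt_id.eventually_ne ht] with z hz hzS
  exact source_of_nonRoot_of_off hq hz hr (fun m hm => hzS ⟨m, by simpa using hm.symm⟩) u v h

lemma countable_setOf_not_nonRoot : {z : ℂ | ¬ NonRoot z}.Countable := by
  have : {z : ℂ | ¬ NonRoot z} ⊆ ⋃ m : ℕ, ((Polynomial.nthRoots m (1 : ℂ)).toFinset : Set ℂ) := by
    intro z hz
    simp only [NonRoot, Set.mem_ofPred_eq, not_forall, not_not] at hz
    obtain ⟨m, hm, hz⟩ := hz
    refine Set.mem_iUnion.2 ⟨m, ?_⟩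
    simpa using (Polynomial.mem_nthRoots hm).2 hz
  exact (Set.countable_iUnion fun m => (Finset.finite_toSet _).countable).mono this

omit [DecidableEq ι] in
lemma Adm.eventually {u v : ι → ℂ} (h : Adm q K u v) : ∀ᶠ z in 𝓝 q, Adm z K u v := by
  have hp : ∀ x y : ℂ, (∀ p : ℕ, p < K → x ≠ q ^ p * y) →
      ∀ᶠ z in 𝓝 q, ∀ p : ℕ, p < K → x ≠ z ^ p * y := by
    intro x y hxy
    have : ∀ᶠ z in 𝓝 q, ∀ p ∈ range K, x ≠ z ^ p * y := by
      refine (eventually_all_finset _).2 fun p hp => ?_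
      have hc : ContinuousAt (fun z : ℂ => z ^ p * y) q := by fun_prop
      exact (hc.eventually_ne (hxy p (mem_range.1 hp)).symm).mono fun z hz => hz.symm
    exact this.mono fun z hz p hp => hz p (mem_range.2 hp)
  have h1 : ∀ w : ι → ℂ, (∀ i j, i ≠ j → ∀ p : ℕ, p < K → w i ≠ q ^ p * w j) →
      ∀ᶠ z in 𝓝 q, ∀ i j, i ≠ j → ∀ p : ℕ, p < K → w i ≠ z ^ p * w j := by
    intro w hw
    refine eventually_all.2 fun i => eventually_all.2 fun j => ?_
    by_cases hij : i = j
    · exact Eventually.of_forall fun z hne => absurd hij hne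
    · exact (hp _ _ (hw i j hij)).mono fun z hz _ => hz
  have h2 : ∀ᶠ z in 𝓝 q, ∀ a j, ∀ p : ℕ, p < K → v a ≠ z ^ p * u j :=
    eventually_all.2 fun a => eventually_all.2 fun j => hp _ _ (h.vu a j)
  filter_upwards [h1 u h.uu, h1 v h.vv, h2] with z hu hv huv
  exact ⟨h.u_ne, h.v_ne, hu, hv, huv⟩

/-- The source identity. -/
theorem source_of_adm (hq : q ≠ 0) (ht : t ≠ 0) (hqq : ∀ p : ℕ, 1 ≤ p → p ≤ K → q ^ p ≠ 1)
    {u v : ι → ℂ} (h : Adm q K u v) : Source K q t u v := by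
  refine source_of_curve (q := fun z => z) (t := fun _ => t) (u := fun _ => u) (v := fun _ => v)
    differentiableAt_fun_id (differentiableAt_const _) (fun i => differentiableAt_const _)
    (fun i => differentiableAt_const _) hq ht hqq h countable_setOf_not_nonRoot ?_
  filter_upwards [continuousAt_id.eventually_ne hq, h.eventually] with z hz hadm hzS
  exact source_of_nonRoot hz ht (by simpa using hzS) u v hadm

end QSource

/-! ### Translation to ordinary and symmetric `q`-Pochhammer symbols. -/

namespace QSource

open Finset

section Pochhammer

variable {q t : ℂ}

lemma prod_mob_eq_qPoch_div {s x : ℂ} {k : ℕ} (h : ∀ m < k, q ^ m * x ≠ 1) :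
    ∏ m ∈ range k, mob s (q ^ m * x) = qPoch (s * x) q k / qPoch x q k := by
  rw [qPoch, qPoch, ← prod_div_distrib]
  refine prod_congr rfl fun m hm => ?_
  rw [mob_of_ne (h m (mem_range.1 hm)), mul_left_comm]

/-- These are the factors comparing a string with its own end. Reversing the product gives the
arguments `q^{-1}, …, q^{-k}`, and inverting each one costs a factor `t⁻¹`, compensated by `t ^ k`.
-/
lemma prod_mob_diag (hq : q ≠ 0) (ht : t ≠ 0) {k : ℕ}
    (hqq : ∀ p : ℕ, 1 ≤ p → p ≤ k → q ^ p ≠ 1) {x : ℂ} (hx : x ≠ 0) :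
    t ^ k * ∏ m ∈ range k, mob t⁻¹ (q ^ m * x / (q ^ k * x)) =
      qPoch (q * t) q k / qPoch q q k := by
  have h1 : t ^ k = ∏ _m ∈ range k, t := by simp
  rw [mul_comm q t, ← prod_mob_eq_qPoch_div, ← prod_range_reflect, h1, ← prod_mul_distrib]
  · refine prod_congr rfl fun m hm => ?_
    have hm' := mem_range.1 hm
    have h2 : q ^ (k - 1 - m) * x / (q ^ k * x) = (q ^ m * q)⁻¹ := by
      have h3 : q ^ (k - 1 - m) * (q ^ m * q) = q ^ k := by
        rw [← pow_succ, ← pow_add]; congr 1; omega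
      rw [← h3, mul_div_mul_right _ _ hx]
      have := pow_ne_zero (k - 1 - m) hq
      have := pow_ne_zero m hq
      field_simp
    rw [h2, mob_inv ht (mul_ne_zero (pow_ne_zero _ hq) hq), mul_inv_cancel_left₀ ht]
    rw [← pow_succ]
    exact hqq _ (by omega) (by omega)
  · intro m hm
    rw [← pow_succ]
    exact hqq _ (by omega) (by omega)

/-- In each quotient of symmetric factors the prefactor `-(s ^ m * w)⁻¹` cancels, leaving only
`c⁻¹`. -/
lemma symQPoch_mul_div {c w s : ℂ} (hc : c ≠ 0) (hw : w ≠ 0) (hs : s ≠ 0) (n : ℕ) :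
    symQPoch (c * w) s n / symQPoch w s n =
      c⁻¹ ^ n * (qPoch (c ^ 2 * w ^ 2) (s ^ 2) n / qPoch (w ^ 2) (s ^ 2) n) := by
  have h1 : c⁻¹ ^ n = ∏ _m ∈ range n, c⁻¹ := by simp
  rw [symQPoch, symQPoch, qPoch, qPoch, ← prod_div_distrib, ← prod_div_distrib, h1,
    ← prod_mul_distrib]
  refine prod_congr rfl fun m _ => ?_
  have hm := pow_ne_zero m hs
  have hx : s ^ m * w ≠ 0 := mul_ne_zero hm hw
  have h2 : s ^ m * (c * w) - (s ^ m)⁻¹ * (c * w)⁻¹ =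
      -(s ^ m * w)⁻¹ * (c⁻¹ * (1 - (s ^ 2) ^ m * (c ^ 2 * w ^ 2))) := by
    field_simp; ring
  have h3 : s ^ m * w - (s ^ m)⁻¹ * w⁻¹ = -(s ^ m * w)⁻¹ * (1 - (s ^ 2) ^ m * w ^ 2) := by
    field_simp; ring
  rw [h2, h3, mul_div_mul_left _ _ (neg_ne_zero.2 (inv_ne_zero hx)), mul_div_assoc]

end Pochhammer

variable {ι : Type*} [Fintype ι] [DecidableEq ι] {K : ℕ} {q t : ℂ}

/-- The summand of the source identity in terms of `q`-Pochhammer symbols. -/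
noncomputable def pochTerm (q t : ℂ) (u v : ι → ℂ) (k : ι → ℕ) : ℂ :=
  (∏ i, qPoch (q * t) q (k i) / qPoch q q (k i)) *
  (∏ i, ∏ j ∈ Finset.univ.erase i,
    qPoch (t⁻¹ * (q ^ k j)⁻¹ * (u i / u j)) q (k i) /
      qPoch ((q ^ k j)⁻¹ * (u i / u j)) q (k i)) *
  (∏ a, ∏ j, qPoch (t * (u j / v a)) q (k j) / qPoch (u j / v a) q (k j))

lemma prod_prod_erase_comm (f : ι → ι → ℂ) :
    ∏ a, ∏ b ∈ univ.erase a, f a b = ∏ b, ∏ a ∈ univ.erase b, f a b :=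
  Finset.prod_comm' (by simp [ne_comm])

lemma pochTerm_inv (u v : ι → ℂ) (k : ι → ℕ) : pochTerm q t v⁻¹ u⁻¹ k =
    (∏ a, qPoch (q * t) q (k a) / qPoch q q (k a)) *
    (∏ a, ∏ b ∈ Finset.univ.erase a,
      qPoch (t⁻¹ * (q ^ k a)⁻¹ * (v a / v b)) q (k b) /
        qPoch ((q ^ k a)⁻¹ * (v a / v b)) q (k b)) *
    (∏ a, ∏ j, qPoch (t * (u j / v a)) q (k a) / qPoch (u j / v a) q (k a)) := by
  simp only [pochTerm, Pi.inv_apply, inv_div_inv]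
  rw [prod_prod_erase_comm, Finset.prod_comm (s := univ) (t := univ)]

lemma pochTerm_eq (hq : q ≠ 0) (ht : t ≠ 0) (hqq : ∀ p : ℕ, 1 ≤ p → p ≤ K → q ^ p ≠ 1)
    {u v : ι → ℂ} (h : Adm q K u v) {k : ι → ℕ} (hk : k ∈ piAntidiag (univ : Finset ι) K) :
    pochTerm q t u v k = t ^ K * term q t u v k := by
  have hne := fun l m c hm => h.mul_ne_node hq hqq hk (l := l) (m := m) (c := c) hm
  have h1 : ∀ i, ∏ j, ∏ m ∈ range (k i), mob t⁻¹ (q ^ m * u i / (q ^ k j * u j)) =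
      (∏ m ∈ range (k i), mob t⁻¹ (q ^ m * u i / (q ^ k i * u i))) *
      ∏ j ∈ univ.erase i, qPoch (t⁻¹ * (q ^ k j)⁻¹ * (u i / u j)) q (k i) /
        qPoch ((q ^ k j)⁻¹ * (u i / u j)) q (k i) := by
    intro i
    rw [← mul_prod_erase univ _ (mem_univ i)]
    congr 1
    refine prod_congr rfl fun j _ => ?_
    have hr : ∀ m : ℕ, q ^ m * u i / (q ^ k j * u j) = q ^ m * ((q ^ k j)⁻¹ * (u i / u j)) := by
      intro m
      have := h.u_ne j
      have := pow_ne_zero (k j) hq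
      field_simp
    simp only [hr]
    rw [prod_mob_eq_qPoch_div, mul_assoc]
    intro m hm h1
    rw [← hr, div_eq_one_iff_eq (mul_ne_zero (pow_ne_zero _ hq) (h.u_ne j))] at h1
    exact hne i m (Sum.inl j) hm h1
  have h2 : ∀ i a, ∏ m ∈ range (k i), mob t (q ^ m * u i / v a) =
      qPoch (t * (u i / v a)) q (k i) / qPoch (u i / v a) q (k i) := by
    intro i a
    simp only [mul_div_assoc]
    rw [prod_mob_eq_qPoch_div]
    intro m hm h1
    rw [← mul_div_assoc, div_eq_one_iff_eq (h.v_ne a)] at h1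
    exact hne i m (Sum.inr a) hm h1
  have h3 : ∏ i, qPoch (q * t) q (k i) / qPoch q q (k i) =
      t ^ K * ∏ i, ∏ m ∈ range (k i), mob t⁻¹ (q ^ m * u i / (q ^ k i * u i)) := by
    have : t ^ K = ∏ i, t ^ k i := by
      rw [prod_pow_eq_pow_sum, (mem_piAntidiag.1 hk).1]
    rw [this, ← prod_mul_distrib]
    refine prod_congr rfl fun i _ => (prod_mob_diag hq ht (fun p hp hpk => hqq p hp
      (hpk.trans (le_of_mem_piAntidiag hk i))) (h.u_ne i)).symm
  have h4 : term q t u v k = (∏ i, ∏ j, ∏ m ∈ range (k i),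
      mob t⁻¹ (q ^ m * u i / (q ^ k j * u j))) *
      ∏ a, ∏ i, ∏ m ∈ range (k i), mob t (q ^ m * u i / v a) := by
    simp only [term, prod_mul_distrib]
    congr 1
    · exact prod_congr rfl fun _ _ => Finset.prod_comm
    · rw [Finset.prod_comm]
      exact prod_congr rfl fun _ _ => Finset.prod_comm
  rw [h4, pochTerm, h3]
  simp only [h1, h2, prod_mul_distrib]
  ring

lemma sum_pochTerm_eq (hq : q ≠ 0) (ht : t ≠ 0) (hqq : ∀ p : ℕ, 1 ≤ p → p ≤ K → q ^ p ≠ 1)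
    {u v : ι → ℂ} (h : Adm q K u v) :
    ∑ k ∈ piAntidiag (univ : Finset ι) K, pochTerm q t u v k =
      ∑ k ∈ piAntidiag (univ : Finset ι) K, pochTerm q t v⁻¹ u⁻¹ k := by
  rw [sum_congr rfl fun k hk => pochTerm_eq hq ht hqq h hk,
    sum_congr rfl fun k hk => pochTerm_eq hq ht hqq h.star hk, ← mul_sum, ← mul_sum]
  exact congrArg _ (source_of_adm hq ht hqq h)

/-- The summand of the source identity in terms of symmetric `q`-Pochhammer symbols. -/
noncomputable def symTerm (s r : ℂ) (x y : ι → ℂ) (k : ι → ℕ) : ℂ :=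
  (∏ i, symQPoch (s * r) s (k i) / symQPoch s s (k i)) *
  (∏ i, ∏ j ∈ Finset.univ.erase i,
    symQPoch (r⁻¹ * (s ^ k j)⁻¹ * (x i / x j)) s (k i) /
      symQPoch ((s ^ k j)⁻¹ * (x i / x j)) s (k i)) *
  (∏ a, ∏ j, symQPoch (r * (x j / y a)) s (k j) / symQPoch (x j / y a) s (k j))

lemma symTerm_inv (s r : ℂ) (x y : ι → ℂ) (k : ι → ℕ) : symTerm s r y⁻¹ x⁻¹ k =
    (∏ a, symQPoch (s * r) s (k a) / symQPoch s s (k a)) *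
    (∏ a, ∏ b ∈ Finset.univ.erase a,
      symQPoch (r⁻¹ * (s ^ k a)⁻¹ * (y a / y b)) s (k b) /
        symQPoch ((s ^ k a)⁻¹ * (y a / y b)) s (k b)) *
    (∏ a, ∏ j, symQPoch (r * (x j / y a)) s (k a) / symQPoch (x j / y a) s (k a)) := by
  simp only [symTerm, Pi.inv_apply, inv_div_inv]
  rw [prod_prod_erase_comm, Finset.prod_comm (s := univ) (t := univ)]

/-- The powers of `r` from the three products combine into a scalar that depends on `k` only through
`|k| = K`, so it factors out of both sums. -/
lemma symTerm_eq {s r : ℂ} (hs : s ≠ 0) (hr : r ≠ 0) {x y : ι → ℂ} (hx : ∀ i, x i ≠ 0)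
    (hy : ∀ a, y a ≠ 0) {k : ι → ℕ} (hk : k ∈ piAntidiag (univ : Finset ι) K) :
    symTerm s r x y k = (r⁻¹ ^ K * (r ^ K) ^ (Fintype.card ι - 1) * (r⁻¹ ^ K) ^ Fintype.card ι) *
      pochTerm (s ^ 2) (r ^ 2) (fun i => x i ^ 2) (fun a => y a ^ 2) k := by
  have hpow : ∀ c : ℂ, ∏ i, c ^ k i = c ^ K := fun c => by
    rw [prod_pow_eq_pow_sum, (mem_piAntidiag.1 hk).1]
  have h1 : ∀ n, symQPoch (s * r) s n / symQPoch s s n =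
      r⁻¹ ^ n * (qPoch (s ^ 2 * r ^ 2) (s ^ 2) n / qPoch (s ^ 2) (s ^ 2) n) := fun n => by
    rw [mul_comm s r, symQPoch_mul_div hr hs hs, mul_comm (r ^ 2)]
  have h2 : ∀ i j, symQPoch (r⁻¹ * (s ^ k j)⁻¹ * (x i / x j)) s (k i) /
      symQPoch ((s ^ k j)⁻¹ * (x i / x j)) s (k i) =
      r ^ k i * (qPoch ((r ^ 2)⁻¹ * ((s ^ 2) ^ k j)⁻¹ * (x i ^ 2 / x j ^ 2)) (s ^ 2) (k i) /
        qPoch (((s ^ 2) ^ k j)⁻¹ * (x i ^ 2 / x j ^ 2)) (s ^ 2) (k i)) := by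
    intro i j
    have hw : (s ^ k j)⁻¹ * (x i / x j) ≠ 0 :=
      mul_ne_zero (inv_ne_zero (pow_ne_zero _ hs)) (div_ne_zero (hx i) (hx j))
    have he : ((s ^ k j)⁻¹ * (x i / x j)) ^ 2 = ((s ^ 2) ^ k j)⁻¹ * (x i ^ 2 / x j ^ 2) := by
      rw [mul_pow, div_pow, inv_pow, ← pow_mul, ← pow_mul, mul_comm 2]
    rw [mul_assoc, symQPoch_mul_div (inv_ne_zero hr) hw hs, he, inv_inv, inv_pow, mul_assoc]
  have h3 : ∀ a j, symQPoch (r * (x j / y a)) s (k j) / symQPoch (x j / y a) s (k j) =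
      r⁻¹ ^ k j * (qPoch (r ^ 2 * (x j ^ 2 / y a ^ 2)) (s ^ 2) (k j) /
        qPoch (x j ^ 2 / y a ^ 2) (s ^ 2) (k j)) := by
    intro a j
    rw [symQPoch_mul_div hr (div_ne_zero (hx j) (hy a)) hs, div_pow]
  simp only [symTerm, pochTerm, h1, h2, h3, prod_mul_distrib, hpow, prod_const,
    card_erase_of_mem (mem_univ _), prod_pow, card_univ]
  ring

lemma sum_symTerm_eq {s r : ℂ} (hs : s ≠ 0) (hr : r ≠ 0)
    (hqq : ∀ p : ℕ, 1 ≤ p → p ≤ K → (s ^ 2) ^ p ≠ 1) {x y : ι → ℂ}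
    (h : Adm (s ^ 2) K (fun i => x i ^ 2) (fun a => y a ^ 2)) :
    ∑ k ∈ piAntidiag (univ : Finset ι) K, symTerm s r x y k =
      ∑ k ∈ piAntidiag (univ : Finset ι) K, symTerm s r y⁻¹ x⁻¹ k := by
  have hx : ∀ i, x i ≠ 0 := fun i hi => h.u_ne i (by simp [hi])
  have hy : ∀ i, y i ≠ 0 := fun i hi => h.v_ne i (by simp [hi])
  rw [sum_congr rfl fun k hk => symTerm_eq hs hr hx hy hk,
    sum_congr rfl fun k hk => symTerm_eq hs hr (x := y⁻¹) (y := x⁻¹)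
      (fun i => inv_ne_zero (hy i)) (fun i => inv_ne_zero (hx i)) hk, ← mul_sum, ← mul_sum,
    sum_pochTerm_eq (pow_ne_zero 2 hs) (pow_ne_zero 2 hr) hqq h]
  have hinv : ∀ w : ι → ℂ, (fun i => w⁻¹ i ^ 2) = (fun i => w i ^ 2)⁻¹ := fun w => by
    funext i; simp
  rw [hinv, hinv]

end QSource

theorem mainTheorem1 (n K : ℕ) (q t : ℂ) (u v : Fin n → ℂ)
    (hq : q ≠ 0) (ht : t ≠ 0) (hu : ∀ i, u i ≠ 0) (hv : ∀ a, v a ≠ 0)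
    (hqq : ∀ p : ℕ, 1 ≤ p → p ≤ K → q ^ p ≠ 1)
    (huu : ∀ i j : Fin n, i ≠ j → ∀ p : ℕ, p < K → u i ≠ q ^ p * u j)
    (hvv : ∀ a b : Fin n, a ≠ b → ∀ p : ℕ, p < K → v a ≠ q ^ p * v b)
    (hvu : ∀ a j : Fin n, ∀ p : ℕ, p < K → v a ≠ q ^ p * u j) :
    (∑ k ∈ Finset.piAntidiag (Finset.univ : Finset (Fin n)) K,
        (∏ i, qPoch (q * t) q (k i) / qPoch q q (k i)) *
        (∏ i, ∏ j ∈ Finset.univ.erase i,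
          qPoch (t⁻¹ * (q ^ k j)⁻¹ * (u i / u j)) q (k i) /
            qPoch ((q ^ k j)⁻¹ * (u i / u j)) q (k i)) *
        (∏ a, ∏ j, qPoch (t * (u j / v a)) q (k j) / qPoch (u j / v a) q (k j)) =
      ∑ k ∈ Finset.piAntidiag (Finset.univ : Finset (Fin n)) K,
        (∏ a, qPoch (q * t) q (k a) / qPoch q q (k a)) *
        (∏ a, ∏ b ∈ Finset.univ.erase a,
          qPoch (t⁻¹ * (q ^ k a)⁻¹ * (v a / v b)) q (k b) /
            qPoch ((q ^ k a)⁻¹ * (v a / v b)) q (k b)) *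
        (∏ a, ∏ j, qPoch (t * (u j / v a)) q (k a) / qPoch (u j / v a) q (k a))) ∧
    (∀ (s r : ℂ) (x y : Fin n → ℂ), s ^ 2 = q → r ^ 2 = t →
      (∀ i, x i ^ 2 = u i) → (∀ a, y a ^ 2 = v a) →
      ∑ k ∈ Finset.piAntidiag (Finset.univ : Finset (Fin n)) K,
        (∏ i, symQPoch (s * r) s (k i) / symQPoch s s (k i)) *
        (∏ i, ∏ j ∈ Finset.univ.erase i,
          symQPoch (r⁻¹ * (s ^ k j)⁻¹ * (x i / x j)) s (k i) /
            symQPoch ((s ^ k j)⁻¹ * (x i / x j)) s (k i)) *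
        (∏ a, ∏ j, symQPoch (r * (x j / y a)) s (k j) / symQPoch (x j / y a) s (k j)) =
      ∑ k ∈ Finset.piAntidiag (Finset.univ : Finset (Fin n)) K,
        (∏ a, symQPoch (s * r) s (k a) / symQPoch s s (k a)) *
        (∏ a, ∏ b ∈ Finset.univ.erase a,
          symQPoch (r⁻¹ * (s ^ k a)⁻¹ * (y a / y b)) s (k b) /
            symQPoch ((s ^ k a)⁻¹ * (y a / y b)) s (k b)) *
        (∏ a, ∏ j, symQPoch (r * (x j / y a)) s (k a) / symQPoch (x j / y a) s (k a))) := by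
  have hadm : QSource.Adm q K u v := ⟨hu, hv, huu, hvv, hvu⟩
  refine ⟨?_, ?_⟩
  · simp only [← QSource.pochTerm_inv]
    exact QSource.sum_pochTerm_eq hq ht hqq hadm
  · rintro s r x y rfl rfl hx hy
    obtain rfl : (fun i => x i ^ 2) = u := funext hx
    obtain rfl : (fun a => y a ^ 2) = v := funext hy
    simp only [← QSource.symTerm_inv]
    exact QSource.sum_symTerm_eq (by rintro rfl; simp at hq) (by rintro rfl; simp at ht) hqq hadm
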